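/- Let $p$ be a prime and let $\Gamma$ be a countable discrete residually finite group. For a unital ring $R$ let $K_1(R)=\mathrm{GL}_\infty(R)/E_\infty(R)$, where $\mathrm{GL}_\infty(R)=\bigcup_r \mathrm{GL}_r(R)$ (with $a\mapsto\mathrm{diag}(a,1)$) and $E_\infty(R)$ is the subgroup generated by the elementary matrices. Assume that the Whitehead group $Wh^{\mathbb{F}_p}(\Gamma)=K_1(\mathbb{F}_p[\Gamma])/\langle\Gamma\rangle$ is torsion, $\langle\Gamma\rangle$ being the image of $\Gamma$. Let $c_0(\Gamma)$ be the convolution algebra of formal series $\sum_\gamma x_\gamma\gamma$ with $x_\gamma\in\mathbb{Q}_p$ and $|x_\gamma|_p\to 0$ as $\gamma\to\infty$, with the norm $\sup_\gamma|x_\gamma|_p$; let $c_0(\Gamma,\mathbb{Z}_p)$ be its subring of series with coefficients in $\mathbb{Z}_p$, and let $\mathrm{tr}_\Gamma: M_r(c_0(\Gamma))\to\mathbb{Q}_p$ send a matrix to the coefficient at the neutral element $e$ of its trace. Then there is a unique homomorphism $\log_p\det_\Gamma: K_1(c_0(\Gamma,\mathbb{Z}_p))\to\mathbb{Q}_p$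 which vanishes on the image of $\Gamma$ and which, for every $r\ge 1$, sends the class of every $g\in 1+pM_r(c_0(\Gamma,\mathbb{Z}_p))$ to $\mathrm{tr}_\Gamma(\log g)$, where $\log g=-\sum_{\nu\ge1}(1-g)^\nu/\nu$. For $f\in\mathrm{GL}_r(c_0(\Gamma,\mathbb{Z}_p))$ write $\log_p\det_\Gamma f$ for its value on the class of $f$. Let $r\ge 1$ and let $f=\sum_\gamma a_\gamma\gamma$, with $a_\gamma \in M_r(\mathbb{Z})$, be an element of $M_r(\mathbb{Z}\Gamma)\cap\mathrm{GL}_r(c_0(\Gamma,\mathbb{Z}_p))$. Let $X_f$ be the set of all sequences $(x_{\gamma'})_{\gamma'\in\Gamma}$ of row vectors in $(\mathbb{R}/\mathbb{Z})^r$ with $\sum_{\gamma'}x_{\gamma'}a^{*}_{\gamma^{-1}\gamma'}=0$ for all $\gamma\in\Gamma$, where $a^*$ is the transpose of $a$, with the left $\Gamma$-action $\gamma(x_{\gamma'})=(x_{\gamma^{-1}\gamma'})$. Let $\log_p:\mathbb{Q}_p^*\to\mathbb{Z}_p$ be the branch of the $p$-adic logarithm with $\log_p(p)=0$. Then for every sequence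 $(\Gamma_n)$ of normal subgroups of finite index in $\Gamma$ such that only $e$ is contained in infinitely many of the $\Gamma_n$, the set $\mathrm{Fix}_{\Gamma_n}(X_f)$ of points of $X_f$ fixed by $\Gamma_n$ is finite and non-empty for all $n$, the $p$-adic entropy $$h_p(f)=\lim_{n\to\infty}\frac{1}{(\Gamma:\Gamma_n)}\log_p|\mathrm{Fix}_{\Gamma_n}(X_f)|$$ exists in $\mathbb{Q}_p$, and $$h_p(f)=\log_p\mathrm{det}_\Gamma f .$$ -/

import Mathlib

/-! ## The group `K₁` of a (not necessarily commutative) ring -/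

noncomputable section KOne

/-- The subgroup `E_ι(R)` of `GL_ι(R)` generated by the elementary matrices, i.e. those with `1`'s
on the diagonal and at most one further non-zero entry. -/
def elementaryGroup (ι R : Type*) [Fintype ι] [DecidableEq ι] [Ring R] : Subgroup (GL ι R) :=
  Subgroup.closure {u | ∃ i j : ι, i ≠ j ∧ ∃ c : R, (u : Matrix ι ι R) = 1 + Matrix.single i j c}

/-- The matrix `diag(a, 1)` of size `n` for a matrix `a` of size `m ≤ n`. -/
def stabMatrix {R : Type*} [Ring R] {m : ℕ} (n : ℕ) (a : Matrix (Fin m) (Fin m) R) :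
    Matrix (Fin n) (Fin n) R :=
  Matrix.of fun i j =>
    if h : (i : ℕ) < m ∧ (j : ℕ) < m then a ⟨i, h.1⟩ ⟨j, h.2⟩ else if i = j then 1 else 0

variable {R : Type*} [Ring R]

theorem stabMatrix_add (m k : ℕ) (a : Matrix (Fin m) (Fin m) R) :
    stabMatrix (m + k) a = Matrix.reindexAlgEquiv ℤ R finSumFinEquiv
      (Matrix.fromBlocks a 0 0 (1 : Matrix (Fin k) (Fin k) R)) := by
  ext i j
  refine Fin.addCases (fun i => ?_) (fun i => ?_) i <;>
    refine Fin.addCases (fun j => ?_) (fun j => ?_) j <;>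
      simp [stabMatrix, Matrix.one_apply, Fin.ext_iff] <;> omega

theorem stabMatrix_one {m n : ℕ} : stabMatrix n (1 : Matrix (Fin m) (Fin m) R) = 1 := by
  ext i j
  by_cases h : (i : ℕ) < m ∧ (j : ℕ) < m <;>
    simp [stabMatrix, Matrix.one_apply, Fin.ext_iff]

theorem stabMatrix_mul {m n : ℕ} (hmn : m ≤ n) (a b : Matrix (Fin m) (Fin m) R) :
    stabMatrix n (a * b) = stabMatrix n a * stabMatrix n b := by
  obtain ⟨k, rfl⟩ := Nat.exists_eq_add_of_le hmn
  simp only [stabMatrix_add, ← map_mul, Matrix.fromBlocks_multiply]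
  simp

theorem stabMatrix_self {m : ℕ} (a : Matrix (Fin m) (Fin m) R) : stabMatrix m a = a := by
  ext i j
  simp [stabMatrix]

theorem stabMatrix_stabMatrix {l m n : ℕ} (hlm : l ≤ m) (a : Matrix (Fin l) (Fin l) R) :
    stabMatrix n (stabMatrix m a) = stabMatrix n a := by
  ext i j
  simp only [stabMatrix, Matrix.of_apply, Fin.ext_iff]
  split_ifs <;> first | rfl | omega

/-- The embedding `GL_m(R) → GL_n(R)`, `a ↦ diag(a, 1)`, for `m ≤ n`. -/
def stabGL (R : Type*) [Ring R] (m n : ℕ) (hmn : m ≤ n) : GL (Fin m) R →* GL (Fin n) R :=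
  Units.map
    { toFun := stabMatrix n
      map_one' := stabMatrix_one
      map_mul' := stabMatrix_mul hmn }

theorem coe_stabGL {m n : ℕ} (h : m ≤ n) (a : GL (Fin m) R) :
    (stabGL R m n h a : Matrix (Fin n) (Fin n) R) = stabMatrix n (a : Matrix (Fin m) (Fin m) R) :=
  rfl

instance stabGL_directedSystem (R : Type*) [Ring R] :
    DirectedSystem (fun n : ℕ => GL (Fin n) R) (fun m n h => stabGL R m n h) where
  map_self _ a := Units.ext (by rw [coe_stabGL, stabMatrix_self])
  map_map _ _ _ hij _ a := Units.ext (by simp only [coe_stabGL, stabMatrix_stabMatrix hij])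

/-- `GL_∞(R)`, the union of the groups `GL_n(R)`. -/
abbrev GLInf (R : Type*) [Ring R] : Type _ :=
  DirectLimit (fun n : ℕ => GL (Fin n) R) (stabGL R)

/-- The canonical embedding `GL_n(R) → GL_∞(R)`. -/
def GLInf.of (R : Type*) [Ring R] (n : ℕ) : GL (Fin n) R →* GLInf R where
  toFun a := ⟦⟨n, a⟩⟧
  map_one' := (DirectLimit.one_def (f := stabGL R) n).symm
  map_mul' a b := (DirectLimit.mul_def (f := stabGL R) n a b).symm

theorem GLInf.of_stab {m n : ℕ} (h : m ≤ n) (a : GL (Fin m) R) :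
    GLInf.of R n (stabGL R m n h a) = GLInf.of R m a :=
  (DirectLimit.eq_of_le (F := fun n : ℕ => GL (Fin n) R) (f := stabGL R)
    (⟨m, a⟩ : Σ n : ℕ, GL (Fin n) R) n h).symm

/-- `E_∞(R) ⊆ GL_∞(R)`, the union of the images of the groups `E_n(R)`. -/
def elementaryInf (R : Type*) [Ring R] : Subgroup (GLInf R) :=
  ⨆ n : ℕ, (elementaryGroup (Fin n) R).map (GLInf.of R n)

/-! The Whitehead lemma: `E_∞(R)` contains all commutators of `GL_∞(R)`; in particular it is
normal with commutative quotient. -/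

section Whitehead

variable {ι κ : Type*} [Fintype ι] [DecidableEq ι] [Fintype κ] [DecidableEq κ]

/-- The unipotent block matrix with upper right block `b`. -/
def upperBlock (b : Matrix ι κ R) : GL (ι ⊕ κ) R where
  val := Matrix.fromBlocks 1 b 0 1
  inv := Matrix.fromBlocks 1 (-b) 0 1
  val_inv := by simp [Matrix.fromBlocks_multiply]
  inv_val := by simp [Matrix.fromBlocks_multiply]

/-- The unipotent block matrix with lower left block `c`. -/
def lowerBlock (c : Matrix κ ι R) : GL (ι ⊕ κ) R where
  val := Matrix.fromBlocks 1 0 c 1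
  inv := Matrix.fromBlocks 1 0 (-c) 1
  val_inv := by simp [Matrix.fromBlocks_multiply]
  inv_val := by simp [Matrix.fromBlocks_multiply]

theorem upperBlock_mem (b : Matrix ι κ R) : upperBlock b ∈ elementaryGroup (ι ⊕ κ) R := by
  induction b using Matrix.induction_on' with
  | h_zero =>
    have : upperBlock (0 : Matrix ι κ R) = 1 := Units.ext (by simp [upperBlock])
    rw [this]; exact one_mem _
  | h_add b c hb hc =>
    have : upperBlock (b + c) = upperBlock b * upperBlock c :=
      Units.ext (by simp [upperBlock, Matrix.fromBlocks_multiply, add_comm])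
    rw [this]; exact mul_mem hb hc
  | h_std_basis i j x =>
    refine Subgroup.subset_closure ⟨Sum.inl i, Sum.inr j, by simp, x, ?_⟩
    ext (a | a) (b | b) <;> simp [upperBlock, Matrix.one_apply, Matrix.single_apply]

theorem lowerBlock_mem (b : Matrix κ ι R) : lowerBlock b ∈ elementaryGroup (ι ⊕ κ) R := by
  induction b using Matrix.induction_on' with
  | h_zero =>
    have : lowerBlock (0 : Matrix κ ι R) = 1 := Units.ext (by simp [lowerBlock])
    rw [this]; exact one_mem _
  | h_add b c hb hc =>
    have : lowerBlock (b + c) = lowerBlock b * lowerBlock c :=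
      Units.ext (by simp [lowerBlock, Matrix.fromBlocks_multiply])
    rw [this]; exact mul_mem hb hc
  | h_std_basis i j x =>
    refine Subgroup.subset_closure ⟨Sum.inr i, Sum.inl j, by simp, x, ?_⟩
    ext (a | a) (b | b) <;> simp [lowerBlock, Matrix.one_apply, Matrix.single_apply]

/-- The block matrix `diag(g, h)`. -/
def diagBlock : GL ι R × GL κ R →* GL (ι ⊕ κ) R where
  toFun g :=
    { val := Matrix.fromBlocks g.1 0 0 g.2
      inv := Matrix.fromBlocks ↑g.1⁻¹ 0 0 ↑g.2⁻¹
      val_inv := by simp [Matrix.fromBlocks_multiply]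
      inv_val := by simp [Matrix.fromBlocks_multiply] }
  map_one' := Units.ext (by simp)
  map_mul' g h := Units.ext (by simp [Matrix.fromBlocks_multiply])

theorem diagBlock_inv_mem (g : GL ι R) : diagBlock (g, g⁻¹) ∈ elementaryGroup (ι ⊕ ι) R := by
  have key : diagBlock (g, g⁻¹) =
      upperBlock (g : Matrix ι ι R) * lowerBlock (-(↑g⁻¹ : Matrix ι ι R)) *
        upperBlock (g : Matrix ι ι R) *
      (upperBlock (-1 : Matrix ι ι R) * lowerBlock (1 : Matrix ι ι R) *
        upperBlock (-1 : Matrix ι ι R)) := by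
    apply Units.ext
    simp [diagBlock, upperBlock, lowerBlock, Matrix.fromBlocks_multiply]
  rw [key]
  exact mul_mem (mul_mem (mul_mem (upperBlock_mem _) (lowerBlock_mem _)) (upperBlock_mem _))
    (mul_mem (mul_mem (upperBlock_mem _) (lowerBlock_mem _)) (upperBlock_mem _))

/-- Elementary matrices stay elementary under a renaming of the indices. -/
theorem elementaryGroup_reindex (e : ι ≃ κ) (u : GL ι R) (hu : u ∈ elementaryGroup ι R) :
    Units.map (Matrix.reindexAlgEquiv ℤ R e : Matrix ι ι R →* Matrix κ κ R) u ∈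
      elementaryGroup κ R := by
  have : elementaryGroup ι R ≤ (elementaryGroup κ R).comap
      (Units.map (Matrix.reindexAlgEquiv ℤ R e : Matrix ι ι R →* Matrix κ κ R)) := by
    refine (Subgroup.closure_le _).2 ?_
    rintro v ⟨i, j, hij, c, hv⟩
    refine Subgroup.subset_closure ⟨e i, e j, by simpa using hij, c, ?_⟩
    simp [hv, Matrix.submatrix_add, Matrix.submatrix_single_equiv, Matrix.submatrix_one_equiv]
  exact this hu

theorem commutator_le_elementaryInf : commutator (GLInf R) ≤ elementaryInf R := by
  rw [commutator_def, Subgroup.commutator_le]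
  rintro x - y -
  obtain ⟨n, g, h, rfl, rfl⟩ := DirectLimit.exists_eq_mk₂ (stabGL R) x y
  rw [commutatorElement_def]
  have hc : (⟦⟨n, g⟩⟧ : GLInf R) * ⟦⟨n, h⟩⟧ * (⟦⟨n, g⟩⟧ : GLInf R)⁻¹ * (⟦⟨n, h⟩⟧ : GLInf R)⁻¹ =
      GLInf.of R n (g * h * g⁻¹ * h⁻¹) := by
    simp only [map_mul, map_inv]
    rfl
  rw [hc, ← GLInf.of_stab (Nat.le_add_right n n)]
  refine Subgroup.mem_iSup_of_mem (n + n) (Subgroup.mem_map_of_mem _ ?_)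
  have key : stabGL R n (n + n) (Nat.le_add_right n n) (g * h * g⁻¹ * h⁻¹) =
      Units.map (Matrix.reindexAlgEquiv ℤ R (finSumFinEquiv (m := n) (n := n)) :
        Matrix (Fin n ⊕ Fin n) (Fin n ⊕ Fin n) R →* Matrix (Fin (n + n)) (Fin (n + n)) R)
      (diagBlock (g, g⁻¹) * diagBlock (h, h⁻¹) * diagBlock ((h * g)⁻¹, ((h * g)⁻¹)⁻¹)) := by
    rw [← map_mul, ← map_mul]
    have : (g, g⁻¹) * (h, h⁻¹) * ((h * g)⁻¹, ((h * g)⁻¹)⁻¹) = ((g * h * g⁻¹ * h⁻¹), (1 : GL (Fin n) R)) := by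
      ext1
      · simp [mul_assoc]
      · simp [mul_assoc]
    rw [this]
    exact Units.ext (stabMatrix_add n n _)
  rw [key]
  exact elementaryGroup_reindex _ _ (mul_mem (mul_mem (diagBlock_inv_mem _) (diagBlock_inv_mem _))
    (diagBlock_inv_mem _))

end Whitehead

instance elementaryInf_normal (R : Type*) [Ring R] : (elementaryInf R).Normal :=
  Subgroup.Normal.of_commutator_le _ commutator_le_elementaryInf

/-- `K₁(R) = GL_∞(R) / E_∞(R)`. -/
def KOne (R : Type*) [Ring R] : Type _ := GLInf R ⧸ elementaryInf R

instance (R : Type*) [Ring R] : CommGroup (KOne R) :=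
  { (inferInstance : Group (GLInf R ⧸ elementaryInf R)) with
    mul_comm := (Subgroup.Normal.quotient_commutative_iff_commutator_le.mpr
      (commutator_le_elementaryInf (R := R))).is_comm.comm }

/-- The class in `K₁(R)` of an invertible matrix. -/
def KOne.mk {R : Type*} [Ring R] {n : ℕ} : GL (Fin n) R →* KOne R :=
  (QuotientGroup.mk' (elementaryInf R)).comp (GLInf.of R n)

/-- The canonical map `Rˣ → K₁(R)`, through the `1 × 1`-matrices. -/
def KOne.ofUnit {R : Type*} [Ring R] : Rˣ →* KOne R :=
  KOne.mk.comp (Units.map (Matrix.scalar (Fin 1) : R →+* Matrix (Fin 1) (Fin 1) R).toMonoidHom)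

end KOne

/-! ## The convolution algebra `c₀(Γ)` -/

noncomputable section CZero

open Filter Topology

/-- The functions `x : Γ → ℚ_p` with `|x_γ|_p → 0` as `γ → ∞`, i.e. such that for every `ε > 0`
one has `|x_γ|_p < ε` outside of a finite subset of `Γ`. -/
def cZeroSubmodule (p : ℕ) [Fact p.Prime] (Γ : Type*) : Submodule ℚ_[p] (Γ → ℚ_[p]) where
  carrier := {x | Tendsto x cofinite (𝓝 0)}
  zero_mem' := tendsto_const_nhds
  add_mem' {x y} hx hy := by
    have h := Tendsto.add (show Tendsto x cofinite (𝓝 0) from hx) hy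
    rw [add_zero] at h
    exact h
  smul_mem' c x hx := by
    have h := Tendsto.const_mul c (show Tendsto x cofinite (𝓝 0) from hx)
    rw [mul_zero] at h
    exact h

/-- `c₀(Γ)`: the formal series `∑ x_γ γ` with `x_γ ∈ ℚ_p` and `|x_γ|_p → 0` as `γ → ∞`. -/
def CZero (p : ℕ) [Fact p.Prime] (Γ : Type*) : Type _ := cZeroSubmodule p Γ

namespace CZero

variable {p : ℕ} [Fact p.Prime] {Γ : Type*}

instance : AddCommGroup (CZero p Γ) := inferInstanceAs (AddCommGroup (cZeroSubmodule p Γ))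

instance : Module ℚ_[p] (CZero p Γ) := inferInstanceAs (Module ℚ_[p] (cZeroSubmodule p Γ))

/-- The coefficient function `γ ↦ x_γ`. -/
def coeff (x : CZero p Γ) : Γ → ℚ_[p] := x.1

@[ext]
theorem ext {x y : CZero p Γ} (h : ∀ γ, x.coeff γ = y.coeff γ) : x = y :=
  Subtype.ext (funext h)

theorem tendsto_coeff (x : CZero p Γ) : Tendsto x.coeff cofinite (𝓝 0) := x.2

@[simp] theorem coeff_zero (γ : Γ) : (0 : CZero p Γ).coeff γ = 0 := rfl

@[simp] theorem coeff_add (x y : CZero p Γ) (γ : Γ) :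
    (x + y).coeff γ = x.coeff γ + y.coeff γ := rfl

@[simp] theorem coeff_neg (x : CZero p Γ) (γ : Γ) : (-x).coeff γ = -x.coeff γ := rfl

@[simp] theorem coeff_sub (x y : CZero p Γ) (γ : Γ) :
    (x - y).coeff γ = x.coeff γ - y.coeff γ := rfl

@[simp] theorem coeff_smul (c : ℚ_[p]) (x : CZero p Γ) (γ : Γ) :
    (c • x).coeff γ = c * x.coeff γ := rfl

theorem summable_coeff (x : CZero p Γ) : Summable x.coeff :=
  NonarchimedeanAddGroup.summable_of_tendsto_cofinite_zero x.tendsto_coeff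

theorem bddAbove_norm_coeff (x : CZero p Γ) : BddAbove (Set.range fun γ => ‖x.coeff γ‖) := by
  have h := x.tendsto_coeff.norm
  rw [norm_zero] at h
  exact h.bddAbove_range_of_cofinite

/-- The norm `‖∑ x_γ γ‖ = sup_γ |x_γ|_p`. -/
instance : NormedAddCommGroup (CZero p Γ) :=
  AddGroupNorm.toNormedAddCommGroup
    { toFun := fun x => ⨆ γ, ‖x.coeff γ‖
      map_zero' := by simp
      add_le' := fun x y => by
        refine Real.iSup_le (fun γ => (norm_add_le _ _).trans ?_)
          (add_nonneg (Real.iSup_nonneg fun _ => norm_nonneg _)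
            (Real.iSup_nonneg fun _ => norm_nonneg _))
        exact add_le_add (le_ciSup x.bddAbove_norm_coeff γ) (le_ciSup y.bddAbove_norm_coeff γ)
      neg' := fun x => by simp
      eq_zero_of_map_eq_zero' := fun x hx => by
        ext γ
        have h : ‖x.coeff γ‖ ≤ ⨆ γ, ‖x.coeff γ‖ := le_ciSup x.bddAbove_norm_coeff γ
        have h' : ‖x.coeff γ‖ ≤ 0 := h.trans_eq hx
        simpa using h' }

theorem norm_def (x : CZero p Γ) : ‖x‖ = ⨆ γ, ‖x.coeff γ‖ := rfl

instance : NonarchimedeanRing ℚ_[p] where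
  is_nonarchimedean := NonarchimedeanAddGroup.is_nonarchimedean

theorem summable_mul (x y : CZero p Γ) :
    Summable fun q : Γ × Γ => x.coeff q.1 * y.coeff q.2 :=
  x.summable_coeff.mul_of_nonarchimedean y.summable_coeff

open Classical in
/-- The series consisting of the single group element `γ`. -/
def single (γ : Γ) : CZero p Γ :=
  ⟨fun δ => if δ = γ then 1 else 0, by
    refine tendsto_nhds_of_eventually_eq ?_
    filter_upwards [(Set.finite_singleton γ).compl_mem_cofinite] with δ hδ
    exact if_neg hδ⟩

open Classical in
theorem coeff_single (γ δ : Γ) :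
    (single γ : CZero p Γ).coeff δ = if δ = γ then 1 else 0 := rfl

variable [Group Γ]

/-- The bijection `(γ, γ') ↦ (γ', γ'⁻¹ γ)` of `Γ × Γ`. -/
def convEquiv (Γ : Type*) [Group Γ] : Γ × Γ ≃ Γ × Γ where
  toFun q := (q.2, q.2⁻¹ * q.1)
  invFun q := (q.1 * q.2, q.1)
  left_inv q := by simp
  right_inv q := by simp

theorem convEquiv_apply (q : Γ × Γ) : convEquiv Γ q = (q.2, q.2⁻¹ * q.1) := rfl

theorem summable_conv (x y : CZero p Γ) :
    Summable fun q : Γ × Γ => x.coeff q.2 * y.coeff (q.2⁻¹ * q.1) :=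
  ((summable_mul x y).comp_injective (convEquiv Γ).injective).congr fun q => by
    rw [Function.comp_apply, convEquiv_apply]

theorem summable_conv_apply (x y : CZero p Γ) (γ : Γ) :
    Summable fun γ' : Γ => x.coeff γ' * y.coeff (γ'⁻¹ * γ) :=
  (summable_conv x y).prod_factor γ

/-- The convolution product `(xy)_γ = ∑_{γ'} x_{γ'} y_{γ'⁻¹ γ}`. -/
instance : Mul (CZero p Γ) where
  mul x y := ⟨fun γ => ∑' γ' : Γ, x.coeff γ' * y.coeff (γ'⁻¹ * γ),
    (summable_conv x y).prod.tendsto_cofinite_zero⟩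

theorem coeff_mul (x y : CZero p Γ) (γ : Γ) :
    (x * y).coeff γ = ∑' γ' : Γ, x.coeff γ' * y.coeff (γ'⁻¹ * γ) := rfl

theorem coeff_single_mul (γ δ : Γ) (x : CZero p Γ) :
    (single γ * x).coeff δ = x.coeff (γ⁻¹ * δ) := by
  rw [coeff_mul, tsum_eq_single γ]
  · simp [coeff_single]
  · intro γ' h
    simp [coeff_single, h]

instance : One (CZero p Γ) := ⟨single 1⟩

theorem one_def : (1 : CZero p Γ) = single 1 := rfl

theorem summable_triple (x y z : CZero p Γ) (γ : Γ) : Summable fun q : Γ × Γ =>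
    x.coeff q.2 * y.coeff (q.2⁻¹ * q.1) * z.coeff (q.1⁻¹ * γ) := by
  refine NonarchimedeanAddGroup.summable_of_tendsto_cofinite_zero ?_
  have h := (summable_conv x y).tendsto_cofinite_zero.norm.mul_const ‖z‖
  rw [norm_zero, zero_mul] at h
  refine squeeze_zero_norm (fun q => ?_) h
  rw [norm_mul]
  exact mul_le_mul_of_nonneg_left (le_ciSup z.bddAbove_norm_coeff _) (norm_nonneg _)

theorem mul_assoc' (x y z : CZero p Γ) : x * y * z = x * (y * z) := by
  ext γ
  have h1 : (x * y * z).coeff γ =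
      ∑' g : Γ, ∑' h : Γ, x.coeff h * y.coeff (h⁻¹ * g) * z.coeff (g⁻¹ * γ) := by
    rw [coeff_mul]
    refine tsum_congr fun g => ?_
    rw [coeff_mul, tsum_mul_right]
  have h2 : (x * (y * z)).coeff γ =
      ∑' h : Γ, ∑' k : Γ, x.coeff h * (y.coeff k * z.coeff (k⁻¹ * (h⁻¹ * γ))) := by
    rw [coeff_mul]
    refine tsum_congr fun h => ?_
    rw [coeff_mul, tsum_mul_left]
  have h3 : (∑' g : Γ, ∑' h : Γ, x.coeff h * y.coeff (h⁻¹ * g) * z.coeff (g⁻¹ * γ)) =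
      ∑' h : Γ, ∑' g : Γ, x.coeff h * y.coeff (h⁻¹ * g) * z.coeff (g⁻¹ * γ) :=
    ((summable_triple x y z γ).tsum_comm
      (f := fun g h => x.coeff h * y.coeff (h⁻¹ * g) * z.coeff (g⁻¹ * γ))).symm
  rw [h1, h2, h3]
  refine tsum_congr fun h => ?_
  rw [← (Equiv.mulLeft h).tsum_eq]
  refine tsum_congr fun k => ?_
  simp only [Equiv.coe_mulLeft, inv_mul_cancel_left, mul_inv_rev, mul_assoc]

instance : Ring (CZero p Γ) :=
  { (inferInstance : AddCommGroup (CZero p Γ)), (inferInstance : Mul (CZero p Γ)),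
    (inferInstance : One (CZero p Γ)) with
    left_distrib := fun x y z => by
      ext γ
      simp only [coeff_mul, coeff_add, mul_add]
      exact (summable_conv_apply x y γ).tsum_add (summable_conv_apply x z γ)
    right_distrib := fun x y z => by
      ext γ
      simp only [coeff_mul, coeff_add, add_mul]
      exact (summable_conv_apply x z γ).tsum_add (summable_conv_apply y z γ)
    zero_mul := fun x => by ext γ; simp [coeff_mul]
    mul_zero := fun x => by ext γ; simp [coeff_mul]
    mul_assoc := mul_assoc'
    one_mul := fun x => by ext γ; simp [one_def, coeff_single_mul]
    mul_one := fun x => by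
      ext γ
      rw [coeff_mul, tsum_eq_single γ]
      · simp [one_def, coeff_single]
      · intro γ' h
        have : γ'⁻¹ * γ ≠ 1 := fun h' => h (inv_mul_eq_one.1 h')
        simp [one_def, coeff_single, this] }

end CZero

/-- `c₀(Γ, ℤ_p)`: the subring of `c₀(Γ)` of the series with coefficients in `ℤ_p`. -/
def CZeroInt (p : ℕ) [Fact p.Prime] (Γ : Type*) [Group Γ] : Subring (CZero p Γ) where
  carrier := {x | ∀ γ, ‖x.coeff γ‖ ≤ 1}
  zero_mem' γ := by simp
  one_mem' γ := by
    rw [CZero.one_def, CZero.coeff_single]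
    split_ifs <;> simp
  add_mem' {x y} hx hy γ := (Padic.nonarchimedean _ _).trans (max_le (hx γ) (hy γ))
  neg_mem' {x} hx γ := by simpa using hx γ
  mul_mem' {x y} hx hy γ := by
    rw [CZero.coeff_mul]
    refine IsUltrametricDist.norm_tsum_le_of_forall_le_of_nonneg zero_le_one fun γ' => ?_
    rw [norm_mul]
    exact mul_le_one₀ (hx _) (norm_nonneg _) (hy _)

namespace CZeroInt

variable (p : ℕ) [Fact p.Prime] {Γ : Type*} [Group Γ]

/-- The homomorphism `Γ → c₀(Γ, ℤ_p)ˣ`. -/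
def ofGroup : Γ →* (CZeroInt p Γ)ˣ :=
  MonoidHom.toHomUnits
    { toFun := fun γ => ⟨CZero.single γ, fun δ => by
        rw [CZero.coeff_single]
        split_ifs <;> simp⟩
      map_one' := rfl
      map_mul' := fun γ γ' => Subtype.ext <| CZero.ext fun δ => by
        classical
        change _ = (CZero.single γ * CZero.single γ' : CZero p Γ).coeff δ
        rw [CZero.coeff_single_mul, CZero.coeff_single, CZero.coeff_single]
        simp only [inv_mul_eq_iff_eq_mul] }

/-- The embedding `ℤΓ → c₀(Γ, ℤ_p)`, `∑ a_γ γ ↦ ∑ a_γ γ`. -/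
def ofGroupRing (a : MonoidAlgebra ℤ Γ) : CZeroInt p Γ :=
  ⟨⟨fun γ => (a.coeff γ : ℚ_[p]), by
    refine tendsto_nhds_of_eventually_eq ?_
    filter_upwards [a.coeff.support.finite_toSet.compl_mem_cofinite] with γ hγ
    simpa using hγ⟩, fun γ => Padic.norm_int_le_one _⟩

end CZeroInt

end CZero

/-! ## The `p`-adic logarithm and `log_p det_Γ` -/

noncomputable section LogDet

/-- The logarithmic series `log u = -∑_{ν ≥ 1} (1 - u)^ν / ν` in a topological `ℚ_p`-algebra. -/
def logSeries (p : ℕ) [Fact p.Prime] {B : Type*} [Ring B] [Module ℚ_[p] B] [TopologicalSpace B]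
    (u : B) : B :=
  -∑' ν : ℕ, ((ν + 1 : ℕ) : ℚ_[p])⁻¹ • (1 - u) ^ (ν + 1)

/-- The branch of the `p`-adic logarithm on `ℚ_pˣ` with `log_p p = 0`. For `x = p ^ v * w` with
`|w|_p = 1`, the element `w ^ (p - 1)` is a `1`-unit and `log_p x = log (w ^ (p - 1)) / (p - 1)`. -/
def padicLog (p : ℕ) [Fact p.Prime] (x : ℚ_[p]) : ℚ_[p] :=
  ((p - 1 : ℕ) : ℚ_[p])⁻¹ * logSeries p ((x * (p : ℚ_[p]) ^ (-x.valuation)) ^ (p - 1))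

variable (p : ℕ) [Fact p.Prime] (Γ : Type*) [Group Γ]

/-- The Whitehead group `Wh^{𝔽_p}(Γ) = K₁(𝔽_p[Γ]) / ⟨Γ⟩`. -/
abbrev WhiteheadGroup : Type _ :=
  KOne (MonoidAlgebra (ZMod p) Γ) ⧸
    (KOne.ofUnit.comp (MonoidHom.toHomUnits (MonoidAlgebra.of (ZMod p) Γ))).range

variable {Γ}

/-- The trace functional `tr_Γ : M_r(c₀(Γ)) → ℚ_p`, `(a_{ij}) ↦ (∑ a_{ii})_e`. -/
def traceGamma {r : ℕ} (a : Matrix (Fin r) (Fin r) (CZero p Γ)) : ℚ_[p] :=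
  a.trace.coeff 1

/-- The map `log_p det_Γ = tr_Γ log` on `1 + p M_r(c₀(Γ, ℤ_p))`. -/
def logDetOneUnit {r : ℕ} (g : Matrix (Fin r) (Fin r) (CZeroInt p Γ)) : ℚ_[p] :=
  traceGamma p (logSeries p (g.map ((↑) : CZeroInt p Γ → CZero p Γ)))

variable (Γ)

/-- The two properties which characterize `log_p det_Γ : K₁(c₀(Γ, ℤ_p)) → ℚ_p`: it is given by
`tr_Γ log` on the `1`-units of all matrix algebras, and it vanishes on the image of `Γ`. -/
def IsLogDet (L : KOne (CZeroInt p Γ) →* Multiplicative ℚ_[p]) : Prop :=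
  (∀ (r : ℕ) (g : GL (Fin r) (CZeroInt p Γ)),
    (∃ a : Matrix (Fin r) (Fin r) (CZeroInt p Γ),
      (g : Matrix (Fin r) (Fin r) (CZeroInt p Γ)) = 1 + p • a) →
    (L (KOne.mk g)).toAdd = logDetOneUnit p (g : Matrix (Fin r) (Fin r) (CZeroInt p Γ))) ∧
  ∀ γ : Γ, (L (KOne.ofUnit (CZeroInt.ofGroup p γ))).toAdd = 0

open Classical in
/-- The homomorphism `log_p det_Γ` on `K₁(c₀(Γ, ℤ_p))`: the one with the two characterizing
properties. (If there is none, it is set to `0`.) -/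
def logDetKOne : KOne (CZeroInt p Γ) →* Multiplicative ℚ_[p] :=
  if h : ∃ L, IsLogDet p Γ L then h.choose else 1

variable {Γ}

/-- `log_p det_Γ` on `GL_r(c₀(Γ, ℤ_p))`. -/
def logDet {r : ℕ} (f : GL (Fin r) (CZeroInt p Γ)) : ℚ_[p] :=
  (logDetKOne p Γ (KOne.mk f)).toAdd

end LogDet

/-! ## Periodic points and `p`-adic entropy -/

noncomputable section Entropy

open Filter Topology

/-- `Γ_n → e`: the `Γ_n` are normal subgroups of finite index such that only the neutral element
is contained in infinitely many of them. -/
structure TendsToIdentity {Γ : Type*} [Group Γ] (N : ℕ → Subgroup Γ) : Prop where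
  normal : ∀ n, (N n).Normal
  finiteIndex : ∀ n, (N n).FiniteIndex
  eq_one : ∀ γ : Γ, {n | γ ∈ N n}.Infinite → γ = 1

/-- The `p`-adic entropy of the action of `Γ` on the set `X` with respect to the sequence `Γ_n`
exists and equals `h`: the sets `Fix_{Γ_n}(X)` are finite and non-empty, and
`(Γ : Γ_n)⁻¹ log_p |Fix_{Γ_n}(X)|` converges to `h`. -/
def HasPadicEntropy (p : ℕ) [Fact p.Prime] {Γ : Type*} [Group Γ] (X : Type*) [MulAction Γ X]
    (N : ℕ → Subgroup Γ) (h : ℚ_[p]) : Prop :=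
  (∀ n, (MulAction.fixedPoints (N n) X).Finite ∧ (MulAction.fixedPoints (N n) X).Nonempty) ∧
  Tendsto (fun n => ((N n).index : ℚ_[p])⁻¹ *
    padicLog p ((MulAction.fixedPoints (N n) X).ncard : ℚ_[p])) atTop (𝓝 h)

variable {Γ : Type*} [Group Γ] {r : ℕ}

/-- `X_f` for `f = ∑ a_γ γ ∈ M_r(ℤ)[Γ] = M_r(ℤΓ)`: the sequences `(x_{γ'})` in `(ℝ/ℤ)^r` such that
`∑_{γ'} x_{γ'} a*_{γ⁻¹ γ'} = 0` for all `γ ∈ Γ`. Here `a*` is the transpose of `a`, so that the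
row vector `x a*` has the components `∑_j a_{ij} x_j`; the sums over `γ'` have finite support. -/
def XSet (f : Matrix (Fin r) (Fin r) (MonoidAlgebra ℤ Γ)) : Set (Γ → Fin r → UnitAddCircle) :=
  {x | ∀ γ : Γ, ∑ᶠ γ' : Γ, (fun i => ∑ j, (f i j).coeff (γ⁻¹ * γ') • x γ' j) = 0}

/-- `X_f` as a type. -/
def XSpace (f : Matrix (Fin r) (Fin r) (MonoidAlgebra ℤ Γ)) : Type _ := XSet f

/-- The left action of `Γ` on `X_f` by `γ (x_{γ'}) = (x_{γ⁻¹ γ'})`. -/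
instance (f : Matrix (Fin r) (Fin r) (MonoidAlgebra ℤ Γ)) : MulAction Γ (XSpace f) where
  smul σ x := ⟨fun γ' => x.1 (σ⁻¹ * γ'), fun γ => by
    have h := x.2 (σ⁻¹ * γ)
    rw [← finsum_comp_equiv (Equiv.mulLeft σ⁻¹)] at h
    simpa [mul_assoc] using h⟩
  one_smul x := Subtype.ext (funext fun γ' => congrArg x.1 (by simp))
  mul_smul σ τ x := Subtype.ext (funext fun γ' => congrArg x.1 (by simp [mul_assoc]))

end Entropy

/-! For a normal subgroup `N` of finite index, `c₀(Γ, ℤ_p)` acts on the functions on `Γ ⧸ N` through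
the permutation representation, and the logarithm of the determinant of this action is a
homomorphism `permLogDet` from `K₁` to `ℚ_p`. The homomorphism `log_p det_Γ` is obtained as the
limit of `permLogDet` divided by the index, and the same determinants count periodic points.

On matrices `g ≡ 1 mod p` one has `log det = tr log` (`logSeries_det`). Since a group element fixes
either all cosets of a normal `N` or none, the trace of the representation is the index times the
sum of the coefficients over `N`. Along `Γ_n → e` that sum tends to the coefficient at `e`
(`CZero.tendsto_tsum_mem`), so the limit is `tr_Γ log g`. On `Γ` the determinants have finite order,
hence logarithm `0`.

Every other class reduces to these two cases. Elementary matrices lift along the surjection `c₀(Γ,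
ℤ_p) → 𝔽_p[Γ]`, so a class that dies in `K₁(𝔽_p[Γ])` is represented by a matrix `≡ 1 mod p`. As
`Wh^{𝔽_p}(Γ)` is torsion, some power of any class is the product of such a class and the class of a
group element (`exists_pow_eq_of_whitehead_torsion`). Division by the exponent in `ℚ_p` gives both
uniqueness and convergence. The limit is a homomorphism because each `permLogDet` is one, and by
uniqueness it does not depend on the sequence.

Finally, a point of `X_f` fixed by `N` is a zero, on a finite-dimensional torus, of the integral
matrix of `f` in the permutation representation. There are `|det|` of these if the determinant is
nonzero (`card_torus_kernel`). It is nonzero because it is a unit of `ℤ_p`, and the absolute value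
is harmless because `log_p (-1) = 0`. -/

/-! ### The `p`-adic logarithm and `log det = tr log` -/

noncomputable section PadicLogarithm

open Filter Topology

variable {p : ℕ} [hp : Fact p.Prime]

/-- The left side is the exact power of `p` dividing `k`. This linear growth of the denominators is
outweighed by the decay `p⁻ᵏ` of the powers in the logarithmic series. -/
theorem Padic.norm_inv_natCast_le (k : ℕ) : ‖((k : ℚ_[p]))⁻¹‖ ≤ k := by
  rcases eq_or_ne k 0 with rfl | hk
  · simp
  have hk' : (k : ℚ_[p]) ≠ 0 := by exact_mod_cast hk
  rw [norm_inv, Padic.norm_eq_zpow_neg_valuation hk', Padic.valuation_natCast, zpow_neg, inv_inv,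
    zpow_natCast]
  exact_mod_cast Nat.le_of_dvd (Nat.pos_of_ne_zero hk) pow_padicValNat_dvd

theorem tendsto_prime_pow_zero : Tendsto (fun n : ℕ => (p : ℚ_[p]) ^ n) atTop (𝓝 0) :=
  tendsto_pow_atTop_nhds_zero_of_norm_lt_one Padic.norm_p_lt_one

/-- Makes the denominator independent of `n`, so that the terms of `((1 + x) ^ (p ^ n) - 1) / p ^ n`
have both a limit and a bound uniform in `n`. -/
theorem natCast_choose_succ_div (n k : ℕ) :
    ((p : ℚ_[p]) ^ n)⁻¹ * ((p ^ n).choose (k + 1) : ℚ_[p]) =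
      ((k + 1 : ℕ) : ℚ_[p])⁻¹ * ((p ^ n - 1).choose k : ℚ_[p]) := by
  have h := Nat.add_one_mul_choose_eq (p ^ n - 1) k
  rw [Nat.sub_add_cancel (Nat.one_le_pow _ _ hp.out.pos)] at h
  have h' : ((p : ℚ_[p]) ^ n) * ((p ^ n - 1).choose k : ℚ_[p]) =
      ((p ^ n).choose (k + 1) : ℚ_[p]) * ((k + 1 : ℕ) : ℚ_[p]) := by exact_mod_cast h
  have hp0 : (p : ℚ_[p]) ^ n ≠ 0 := pow_ne_zero _ (by exact_mod_cast hp.out.ne_zero)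
  have hk : ((k + 1 : ℕ) : ℚ_[p]) ≠ 0 := by exact_mod_cast k.succ_ne_zero
  rw [inv_mul_eq_iff_eq_mul₀ hp0, mul_left_comm, h', mul_comm _ ((k + 1 : ℕ) : ℚ_[p]),
    inv_mul_cancel_left₀ hk]

/-- Since `p ^ n - 1 → -1`, the limit is the binomial coefficient of `-1` over `k`. The induction
uses Pascal's rule, in which the entry from row `p ^ n` is `p ^ n` times a convergent sequence. -/
theorem tendsto_choose_prime_pow_sub_one (k : ℕ) :
    Tendsto (fun n : ℕ => ((p ^ n - 1).choose k : ℚ_[p])) atTop (𝓝 ((-1) ^ k)) := by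
  induction k with
  | zero => simp
  | succ k ih =>
    have h : ∀ n : ℕ, ((p ^ n - 1).choose (k + 1) : ℚ_[p]) =
        (p : ℚ_[p]) ^ n * (((k + 1 : ℕ) : ℚ_[p])⁻¹ * ((p ^ n - 1).choose k : ℚ_[p])) -
          ((p ^ n - 1).choose k : ℚ_[p]) := fun n => by
      have hp0 : (p : ℚ_[p]) ^ n ≠ 0 := pow_ne_zero _ (by exact_mod_cast hp.out.ne_zero)
      rw [← natCast_choose_succ_div, mul_inv_cancel_left₀ hp0]
      have h := Nat.choose_succ_succ (p ^ n - 1) k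
      rw [Nat.succ_eq_add_one, Nat.sub_add_cancel (Nat.one_le_pow _ _ hp.out.pos)] at h
      rw [h]
      push_cast
      ring
    simp_rw [h]
    have := (tendsto_prime_pow_zero.mul (ih.const_mul ((k + 1 : ℕ) : ℚ_[p])⁻¹)).sub ih
    rwa [zero_mul, zero_sub, ← neg_one_mul, ← pow_succ'] at this

theorem summable_log_bound : Summable fun k : ℕ => ((k + 1 : ℕ) : ℝ) * ((p : ℝ)⁻¹) ^ (k + 1) := by
  have h1 : ‖(p : ℝ)⁻¹‖ < 1 := by
    rw [norm_inv, Real.norm_natCast]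
    exact inv_lt_one_of_one_lt₀ (by exact_mod_cast hp.out.one_lt)
  have := summable_pow_mul_geometric_of_norm_lt_one 1 h1
  simp only [pow_one] at this
  exact (summable_nat_add_iff 1).2 this

theorem norm_log_term_le {E : Type*} [NormedAddCommGroup E] [Module ℚ_[p] E]
    (hE : ∀ (c : ℚ_[p]) (x : E), ‖c • x‖ ≤ ‖c‖ * ‖x‖) (k : ℕ) {x : E}
    (hx : ‖x‖ ≤ ((p : ℝ)⁻¹) ^ (k + 1)) :
    ‖((k + 1 : ℕ) : ℚ_[p])⁻¹ • x‖ ≤ ((k + 1 : ℕ) : ℝ) * ((p : ℝ)⁻¹) ^ (k + 1) :=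
  (hE _ _).trans <| mul_le_mul (Padic.norm_inv_natCast_le _) hx (norm_nonneg _) (Nat.cast_nonneg _)

/-- The coefficientwise form of `log (1 + x) = lim ((1 + x) ^ (p ^ n) - 1) / p ^ n`. -/
theorem tendsto_sum_choose_log (s : ℕ → ℚ_[p]) (hs : ∀ k, ‖s k‖ ≤ ((p : ℝ)⁻¹) ^ k) :
    Tendsto (fun n : ℕ => ((p : ℚ_[p]) ^ n)⁻¹ *
      ∑ k ∈ Finset.range (p ^ n), ((p ^ n).choose (k + 1) : ℚ_[p]) * s (k + 1)) atTop
      (𝓝 (-∑' k : ℕ, ((k + 1 : ℕ) : ℚ_[p])⁻¹ * ((-1 : ℤ) ^ (k + 1) • s (k + 1)))) := by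
  have h : ∀ n : ℕ, ((p : ℚ_[p]) ^ n)⁻¹ *
      ∑ k ∈ Finset.range (p ^ n), ((p ^ n).choose (k + 1) : ℚ_[p]) * s (k + 1) =
      ∑' k : ℕ, (((k + 1 : ℕ) : ℚ_[p])⁻¹ * ((p ^ n - 1).choose k : ℚ_[p])) * s (k + 1) := fun n => by
    rw [Finset.mul_sum, tsum_eq_sum (s := Finset.range (p ^ n))]
    · refine Finset.sum_congr rfl fun k _ => ?_
      rw [← natCast_choose_succ_div, mul_assoc]
    · intro k hk
      rw [Finset.mem_range, not_lt] at hk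
      rw [← natCast_choose_succ_div, Nat.choose_eq_zero_of_lt (by omega)]
      simp
  simp_rw [h]
  rw [← tsum_neg]
  -- Binomial coefficients are integers, of norm at most `1`, so the bound on the terms does not
  -- depend on `n`.
  refine tendsto_tsum_of_dominated_convergence (summable_log_bound (p := p)) (fun k => ?_)
    (Eventually.of_forall fun n k => ?_)
  · have := ((tendsto_choose_prime_pow_sub_one (p := p) k).const_mul
      ((k + 1 : ℕ) : ℚ_[p])⁻¹).mul_const (s (k + 1))
    convert this using 2
    rw [zsmul_eq_mul]
    push_cast
    ring
  · rw [mul_assoc, ← smul_eq_mul]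
    refine norm_log_term_le (fun c x => (norm_smul c x).le) k ?_
    rw [norm_mul]
    refine (mul_le_of_le_one_left (norm_nonneg _) ?_).trans (hs _)
    exact_mod_cast Padic.norm_int_le_one (p := p) ((p ^ n - 1).choose k : ℤ)

theorem add_one_pow_sub_one_eq_sum {B : Type*} [Ring B] (x : B) (N : ℕ) :
    (1 + x) ^ N - 1 = ∑ k ∈ Finset.range N, N.choose (k + 1) • x ^ (k + 1) := by
  rw [add_comm, (Commute.one_right x).add_pow, Finset.sum_range_succ']
  simp [nsmul_eq_mul, (Nat.cast_commute _ _).eq]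

theorem norm_natCast_prime : ‖(p : ℚ_[p])‖ = (p : ℝ)⁻¹ := Padic.norm_p

section Matrix

variable {m : Type*} [Fintype m] [DecidableEq m]

/-- The matrix over `ℚ_p` with the same entries as a matrix over `ℤ_p`. -/
def Matrix.coePadic : Matrix m m ℤ_[p] →+* Matrix m m ℚ_[p] := (PadicInt.Coe.ringHom).mapMatrix

theorem Matrix.coePadic_apply (A : Matrix m m ℤ_[p]) (i j : m) :
    Matrix.coePadic A i j = (A i j : ℚ_[p]) := rfl

theorem norm_entry_pow_le (A : Matrix m m ℤ_[p]) (k : ℕ) (i j : m) :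
    ‖(Matrix.coePadic ((p • A) ^ k)) i j‖ ≤ ((p : ℝ)⁻¹) ^ k := by
  rw [smul_pow, Matrix.coePadic_apply, Matrix.smul_apply, nsmul_eq_mul]
  push_cast
  rw [norm_mul, norm_pow, norm_natCast_prime]
  exact mul_le_of_le_one_right (by positivity) (PadicInt.norm_le_one _)

theorem one_sub_one_add_pow {B : Type*} [Ring B] (x : B) (k : ℕ) :
    (1 - (1 + x)) ^ k = (-1 : ℤ) ^ k • x ^ k := by
  rw [sub_add_cancel_left, ← neg_one_zsmul, smul_pow]

theorem norm_log_matrix_term_le (A : Matrix m m ℤ_[p]) (i j : m) (k : ℕ) :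
    ‖(((k + 1 : ℕ) : ℚ_[p])⁻¹ • (1 - Matrix.coePadic (1 + p • A)) ^ (k + 1) : Matrix m m ℚ_[p]) i j‖ ≤
      ((k + 1 : ℕ) : ℝ) * ((p : ℝ)⁻¹) ^ (k + 1) := by
  rw [Matrix.smul_apply]
  refine norm_log_term_le (fun c x => (norm_smul c x).le) k ?_
  rw [map_add, map_one, sub_add_cancel_left, ← map_neg, ← map_pow, ← smul_neg]
  exact norm_entry_pow_le _ _ _ _

theorem summable_log_matrix (A : Matrix m m ℤ_[p]) : Summable fun k : ℕ =>
    ((k + 1 : ℕ) : ℚ_[p])⁻¹ • (1 - Matrix.coePadic (1 + p • A)) ^ (k + 1) :=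
  Pi.summable.2 fun i => Pi.summable.2 fun j =>
    Summable.of_norm_bounded (summable_log_bound (p := p)) fun k => norm_log_matrix_term_le A i j k

theorem logSeries_matrix_apply (A : Matrix m m ℤ_[p]) (i j : m) :
    logSeries p (Matrix.coePadic (1 + p • A)) i j = -∑' k : ℕ,
      (((k + 1 : ℕ) : ℚ_[p])⁻¹ • (1 - Matrix.coePadic (1 + p • A)) ^ (k + 1) : Matrix m m ℚ_[p]) i j := by
  rw [logSeries, Matrix.neg_apply,
    (Pi.hasSum.1 (Pi.hasSum.1 (summable_log_matrix A).hasSum i) j).tsum_eq]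

theorem tendsto_log_matrix (A : Matrix m m ℤ_[p]) (i j : m) :
    Tendsto (fun n : ℕ => ((p : ℚ_[p]) ^ n)⁻¹ *
      (Matrix.coePadic ((1 + p • A) ^ p ^ n - 1)) i j) atTop
      (𝓝 (logSeries p (Matrix.coePadic (1 + p • A)) i j)) := by
  have := tendsto_sum_choose_log (fun k => Matrix.coePadic ((p • A) ^ k) i j)
    fun k => norm_entry_pow_le A k i j
  convert this using 2 with n
  · rw [add_one_pow_sub_one_eq_sum, map_sum, Matrix.sum_apply]
    refine congrArg _ (Finset.sum_congr rfl fun k _ => ?_)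
    rw [map_nsmul, Matrix.smul_apply, nsmul_eq_mul]
  · rw [logSeries_matrix_apply]
    congr 1
    refine tsum_congr fun k => ?_
    rw [map_add, map_one, one_sub_one_add_pow, ← map_pow, Matrix.smul_apply, smul_eq_mul,
      Matrix.smul_apply]

theorem tendsto_logSeries (d : ℤ_[p]) :
    Tendsto (fun n : ℕ => ((p : ℚ_[p]) ^ n)⁻¹ * (((1 + p * d : ℤ_[p]) : ℚ_[p]) ^ p ^ n - 1)) atTop
      (𝓝 (logSeries p ((1 + p * d : ℤ_[p]) : ℚ_[p]))) := by
  have := tendsto_sum_choose_log (fun k => ((p * d : ℤ_[p]) : ℚ_[p]) ^ k) fun k => by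
    push_cast
    rw [norm_pow, norm_mul, norm_natCast_prime]
    exact pow_le_pow_left₀ (by positivity)
      (mul_le_of_le_one_right (by positivity) (PadicInt.norm_le_one _)) _
  convert this using 2 with n
  · rw [PadicInt.coe_add, PadicInt.coe_one, add_one_pow_sub_one_eq_sum]
    simp only [nsmul_eq_mul]
  · rw [logSeries, PadicInt.coe_add, PadicInt.coe_one]
    simp only [one_sub_one_add_pow, smul_eq_mul]

/-- The congruence `a ≡ b mod p ⇒ a ^ p ^ n ≡ b ^ p ^ n mod p ^ (n + 1)` needs a commutative ring;
it is taken in `ℤ[X]` and evaluated at `A`. The extra factor `p` is absorbed into `L`. -/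
theorem exists_one_add_pow_prime_pow (A : Matrix m m ℤ_[p]) (n : ℕ) :
    ∃ L : Matrix m m ℤ_[p], (1 + p • A) ^ p ^ n = 1 + ((p : ℤ_[p]) ^ n) • L := by
  obtain ⟨q, hq⟩ := dvd_sub_pow_of_dvd_sub (R := Polynomial ℤ) (p := p)
    (a := 1 + p • Polynomial.X) (b := 1) (by simp [nsmul_eq_mul]) n
  refine ⟨p • Polynomial.aeval A q, ?_⟩
  have := congrArg (Polynomial.aeval A) hq
  simp only [map_sub, map_pow, map_add, map_one, one_pow, map_mul, map_nsmul, Polynomial.aeval_X,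
    map_natCast] at this
  rw [sub_eq_iff_eq_add'] at this
  rw [this, ← Nat.cast_pow, ← Nat.cast_pow, Nat.cast_smul_eq_nsmul, smul_smul, ← pow_succ,
    nsmul_eq_mul]

/-- On matrices `≡ 1 mod p` one has `log det = tr log`. -/
theorem logSeries_det (A : Matrix m m ℤ_[p]) :
    (∃ d : ℤ_[p], (1 + p • A).det = 1 + p * d) ∧
    logSeries p (((1 + p • A).det : ℤ_[p]) : ℚ_[p]) =
      (logSeries p (Matrix.coePadic (1 + p • A))).trace := by
  have hdet : ∃ d : ℤ_[p], (1 + p • A).det = 1 + p * d := by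
    rw [← Nat.cast_smul_eq_nsmul ℤ_[p], Matrix.det_one_add_smul]
    exact ⟨_, by rw [add_assoc, pow_two, ← mul_assoc, ← add_mul, mul_comm (p : ℤ_[p])]⟩
  refine ⟨hdet, ?_⟩
  obtain ⟨d, hd⟩ := hdet
  choose L hL using exists_one_add_pow_prime_pow A
  have hp0 : ∀ n, (p : ℚ_[p]) ^ n ≠ 0 := fun n => pow_ne_zero _ (by exact_mod_cast hp.out.ne_zero)
  have h1 : Tendsto (fun n => (Matrix.coePadic (L n)).trace) atTop
      (𝓝 (logSeries p (Matrix.coePadic (1 + p • A))).trace) := by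
    refine tendsto_finsetSum _ fun i _ => ?_
    refine (tendsto_log_matrix A i i).congr fun n => ?_
    rw [hL, add_sub_cancel_left, Matrix.coePadic_apply, Matrix.smul_apply, smul_eq_mul]
    push_cast
    rw [inv_mul_cancel_left₀ (hp0 n)]
    rfl
  have h2 := tendsto_logSeries d
  rw [← hd] at h2
  refine tendsto_nhds_unique h2 ?_
  -- Expansion of `det (1 + p ^ n L)` as `1 + p ^ n tr L + p ^ (2n) S`: after division by `p ^ n`
  -- only the trace survives in the limit.
  have h3 : ∀ n, ∃ S : ℤ_[p], ((p : ℚ_[p]) ^ n)⁻¹ *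
      ((((1 + p • A).det : ℤ_[p]) : ℚ_[p]) ^ p ^ n - 1) =
      (Matrix.coePadic (L n)).trace + (p : ℚ_[p]) ^ n * S := fun n => by
    have h := Matrix.det_one_add_smul ((p : ℤ_[p]) ^ n) (L n)
    rw [← hL, Matrix.det_pow] at h
    have h' := congrArg ((↑) : ℤ_[p] → ℚ_[p]) h
    have htr : (Matrix.coePadic (L n)).trace = ((L n).trace : ℤ_[p]) := by
      rw [Matrix.coePadic, RingHom.mapMatrix_apply]
      exact (AddMonoidHom.map_trace (PadicInt.Coe.ringHom (p := p)) _).symm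
    set S := Polynomial.eval ((p : ℤ_[p]) ^ n)
      (Matrix.det (1 + (Polynomial.X : Polynomial ℤ_[p]) • (L n).map Polynomial.C)).divX.divX
    refine ⟨S, ?_⟩
    push_cast at h'
    rw [htr, inv_mul_eq_iff_eq_mul₀ (hp0 n), h']
    ring
  choose S hS using h3
  simp_rw [hS]
  have h4 : Tendsto (fun n => (p : ℚ_[p]) ^ n * (S n : ℚ_[p])) atTop (𝓝 0) := by
    have h5 := (tendsto_prime_pow_zero (p := p)).norm
    rw [norm_zero] at h5
    refine squeeze_zero_norm (fun n => ?_) h5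
    rw [norm_mul]
    exact mul_le_of_le_one_right (norm_nonneg _) (PadicInt.norm_le_one _)
  simpa using h1.add h4

end Matrix

/-- With `M = p ^ n`, divide `(uv) ^ M - 1 = (u ^ M - 1) v ^ M + (v ^ M - 1)` by `p ^ n` and let `n
→ ∞`, using `v ^ M → 1`. -/
theorem logSeries_mul {u v : ℤ_[p]} (hu : ∃ d : ℤ_[p], u = 1 + p * d)
    (hv : ∃ d : ℤ_[p], v = 1 + p * d) :
    logSeries p ((u * v : ℤ_[p]) : ℚ_[p]) = logSeries p (u : ℚ_[p]) + logSeries p (v : ℚ_[p]) := by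
  obtain ⟨d, hd⟩ := hu
  obtain ⟨e, he⟩ := hv
  have hu := tendsto_logSeries d
  have hv := tendsto_logSeries e
  have huv := tendsto_logSeries (d + e + (p : ℤ_[p]) * (d * e))
  rw [show 1 + (p : ℤ_[p]) * (d + e + p * (d * e)) = u * v by rw [hd, he]; ring] at huv
  rw [← hd] at hu
  rw [← he] at hv
  refine tendsto_nhds_unique huv ?_
  have h1 : Tendsto (fun n : ℕ => (v : ℚ_[p]) ^ p ^ n) atTop (𝓝 1) := by
    have := ((tendsto_prime_pow_zero (p := p)).mul hv).add_const 1
    rw [zero_mul, zero_add] at this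
    refine this.congr fun n => ?_
    rw [mul_inv_cancel_left₀ (pow_ne_zero _ (by exact_mod_cast hp.out.ne_zero)), sub_add_cancel]
  have := (hu.mul h1).add hv
  rw [mul_one] at this
  refine this.congr fun n => ?_
  push_cast
  ring

theorem logSeries_one : logSeries p (1 : ℚ_[p]) = 0 := by
  simp [logSeries]

theorem logSeries_pow {u : ℤ_[p]} (hu : ∃ d : ℤ_[p], u = 1 + p * d) (k : ℕ) :
    (∃ d : ℤ_[p], u ^ k = 1 + p * d) ∧
      logSeries p ((u ^ k : ℤ_[p]) : ℚ_[p]) = k * logSeries p (u : ℚ_[p]) := by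
  induction k with
  | zero => exact ⟨⟨0, by simp⟩, by simp [logSeries_one]⟩
  | succ k ih =>
    refine ⟨?_, ?_⟩
    · obtain ⟨d, hd⟩ := hu
      obtain ⟨e, he⟩ := ih.1
      exact ⟨d + e + p * (d * e), by rw [pow_succ, he, hd]; ring⟩
    · rw [pow_succ, logSeries_mul ih.1 hu, ih.2]
      push_cast
      ring

theorem exists_units_pow_sub_one_eq (u : ℤ_[p]ˣ) :
    ∃ d : ℤ_[p], (u : ℤ_[p]) ^ (p - 1) = 1 + p * d := by
  have h : PadicInt.toZMod ((u : ℤ_[p]) ^ (p - 1) - 1) = 0 := by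
    rw [map_sub, map_pow, map_one, sub_eq_zero]
    exact ZMod.pow_card_sub_one_eq_one ((Units.isUnit u).map PadicInt.toZMod).ne_zero
  rw [← RingHom.mem_ker, PadicInt.ker_toZMod, PadicInt.maximalIdeal_eq_span_p,
    Ideal.mem_span_singleton] at h
  obtain ⟨d, hd⟩ := h
  exact ⟨d, by rw [← hd]; ring⟩

theorem padicLog_units (u : ℤ_[p]ˣ) : padicLog p ((u : ℤ_[p]) : ℚ_[p]) =
    ((p - 1 : ℕ) : ℚ_[p])⁻¹ * logSeries p (((u : ℤ_[p]) ^ (p - 1) : ℤ_[p]) : ℚ_[p]) := by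
  have hv : ((u : ℤ_[p]) : ℚ_[p]).valuation = 0 := by
    have h := PadicInt.valuation_mul u.ne_zero (u⁻¹).ne_zero
    rw [Units.mul_inv, PadicInt.valuation_one] at h
    rw [PadicInt.valuation_coe]
    omega
  rw [padicLog, hv, neg_zero, zpow_zero, mul_one, PadicInt.coe_pow]

theorem padicLog_units_mul (u v : ℤ_[p]ˣ) : padicLog p (((u * v : ℤ_[p]ˣ) : ℤ_[p]) : ℚ_[p]) =
    padicLog p ((u : ℤ_[p]) : ℚ_[p]) + padicLog p ((v : ℤ_[p]) : ℚ_[p]) := by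
  rw [padicLog_units, padicLog_units, padicLog_units, Units.val_mul, mul_pow,
    logSeries_mul (exists_units_pow_sub_one_eq u) (exists_units_pow_sub_one_eq v), mul_add]

/-- The `p`-adic logarithm on the units of `ℤ_p`. -/
def unitLog (p : ℕ) [Fact p.Prime] : ℤ_[p]ˣ →* Multiplicative ℚ_[p] where
  toFun u := Multiplicative.ofAdd (padicLog p ((u : ℤ_[p]) : ℚ_[p]))
  map_one' := by
    rw [padicLog_units, Units.val_one, one_pow, PadicInt.coe_one, logSeries_one, mul_zero, ofAdd_zero]
  map_mul' u v := by rw [padicLog_units_mul, ofAdd_add]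

theorem unitLog_apply (u : ℤ_[p]ˣ) :
    (unitLog p u).toAdd = padicLog p ((u : ℤ_[p]) : ℚ_[p]) := rfl

theorem unitLog_of_one_unit {u : ℤ_[p]ˣ} (hu : ∃ d : ℤ_[p], (u : ℤ_[p]) = 1 + p * d) :
    (unitLog p u).toAdd = logSeries p ((u : ℤ_[p]) : ℚ_[p]) := by
  have h1 : ((p - 1 : ℕ) : ℚ_[p]) ≠ 0 := by
    exact_mod_cast (Nat.sub_pos_of_lt hp.out.one_lt).ne'
  rw [unitLog_apply, padicLog_units, (logSeries_pow hu _).2, inv_mul_cancel_left₀ h1]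

theorem unitLog_of_pow_eq_one {u : ℤ_[p]ˣ} {k : ℕ} (hk : k ≠ 0) (hu : u ^ k = 1) :
    unitLog p u = 1 := by
  have h := congrArg (unitLog p) hu
  rw [map_pow, map_one] at h
  have h' := congrArg Multiplicative.toAdd h
  rw [toAdd_pow, toAdd_one, smul_eq_zero] at h'
  exact Multiplicative.toAdd.injective (h'.resolve_left hk)

/-- Periodic points are counted by `|det|`, while the homomorphism on `K₁` sees `det`; this removes
the sign. -/
theorem padicLog_neg_units (u : ℤ_[p]ˣ) :
    padicLog p (-((u : ℤ_[p]) : ℚ_[p])) = padicLog p ((u : ℤ_[p]) : ℚ_[p]) := by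
  have h1 : unitLog p (-1) = 1 := unitLog_of_pow_eq_one two_ne_zero (by simp)
  have h2 : unitLog p (-u) = unitLog p u := by rw [← neg_one_mul, map_mul, h1, one_mul]
  have h3 := congrArg Multiplicative.toAdd h2
  rwa [unitLog_apply, unitLog_apply, Units.val_neg, PadicInt.coe_neg] at h3

end PadicLogarithm

/-! ### The action of `c₀(Γ)` on finite `Γ`-sets -/

noncomputable section PermutationRepresentation

open Filter Topology

variable {p : ℕ} [hp : Fact p.Prime] {Γ : Type*}

namespace CZero

theorem norm_coeff_le (x : CZero p Γ) (γ : Γ) : ‖x.coeff γ‖ ≤ ‖x‖ :=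
  le_ciSup x.bddAbove_norm_coeff γ

theorem norm_smul_le' (c : ℚ_[p]) (x : CZero p Γ) : ‖c • x‖ ≤ ‖c‖ * ‖x‖ := by
  refine Real.iSup_le (fun γ => ?_) (mul_nonneg (norm_nonneg _) (norm_nonneg _))
  rw [coeff_smul, norm_mul]
  exact mul_le_mul_of_nonneg_left (norm_coeff_le x γ) (norm_nonneg _)

/-- For discrete `Γ` this is the space of continuous functions vanishing at infinity, with the sup
norm. Completeness makes the logarithmic series summable. -/
instance : CompleteSpace (CZero p Γ) := by
  let _ : TopologicalSpace Γ := ⊥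
  have : DiscreteTopology Γ := ⟨rfl⟩
  let e : CZero p Γ ≃ ZeroAtInftyContinuousMap Γ ℚ_[p] :=
    { toFun := fun x => ⟨⟨x.coeff, continuous_of_discreteTopology⟩, by
        rw [cocompact_eq_cofinite]; exact x.tendsto_coeff⟩
      invFun := fun f => ⟨f, by
        have := f.zero_at_infty'
        rwa [cocompact_eq_cofinite] at this⟩
      left_inv := fun x => rfl
      right_inv := fun f => rfl }
  have he : Isometry e := by
    refine Isometry.of_dist_eq fun x y => ?_
    rw [dist_eq_norm, dist_eq_norm, ← ZeroAtInftyContinuousMap.norm_toBCF_eq_norm,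
      BoundedContinuousFunction.norm_eq_iSup_norm]
    rfl
  exact (IsometryEquiv.mk e he).completeSpace

theorem summable_ite (x : CZero p Γ) (P : Γ → Prop) [DecidablePred P] :
    Summable fun γ => if P γ then x.coeff γ else 0 := by
  have := x.summable_coeff.indicator {γ | P γ}
  refine this.congr fun γ => ?_
  rw [Set.indicator_apply]
  rfl

theorem norm_tsum_ite_le (x : CZero p Γ) (P : Γ → Prop) [DecidablePred P] {C : ℝ} (hC : 0 ≤ C)
    (h : ∀ γ, P γ → ‖x.coeff γ‖ ≤ C) : ‖∑' γ, if P γ then x.coeff γ else 0‖ ≤ C := by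
  refine IsUltrametricDist.norm_tsum_le_of_forall_le_of_nonneg hC fun γ => ?_
  split_ifs with hγ
  · exact h γ hγ
  · simpa using hC

variable [Group Γ] {Q : Type*} [Fintype Q] [DecidableEq Q] [MulAction Γ Q]

theorem coeff_one_ite (γ : Γ) [Decidable (γ = 1)] :
    (1 : CZero p Γ).coeff γ = if γ = 1 then 1 else 0 := by
  rw [one_def, coeff_single]
  congr

omit [Fintype Q] in
-- Substitute `γ = h δ`, so that `γ • c = a` becomes `δ • c = h⁻¹ • a`; exchanging the sums is
-- allowed because the family is summable over `Γ × Γ`.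
theorem tsum_ite_mul (x y : CZero p Γ) (a c : Q) :
    (∑' γ, if γ • c = a then (x * y).coeff γ else 0) =
      ∑' h, x.coeff h * ∑' δ : Γ, if δ • c = h⁻¹ • a then y.coeff δ else 0 := by
  have h1 : ∀ γ : Γ, (if γ • c = a then (x * y).coeff γ else 0) =
      ∑' h : Γ, if γ • c = a then x.coeff h * y.coeff (h⁻¹ * γ) else 0 := fun γ => by
    split_ifs
    · rw [coeff_mul]
    · rw [tsum_zero]
  have hs : Summable fun q : Γ × Γ =>
      if q.2 • c = a then x.coeff q.1 * y.coeff (q.1⁻¹ * q.2) else 0 := by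
    have := ((summable_conv x y).indicator {q | q.1 • c = a}).comp_injective
      (Equiv.prodComm Γ Γ).injective
    refine this.congr fun q => ?_
    rw [Function.comp_apply, Set.indicator_apply]
    rfl
  simp_rw [h1]
  rw [hs.tsum_comm (f := fun h γ => if γ • c = a then x.coeff h * y.coeff (h⁻¹ * γ) else 0)]
  refine tsum_congr fun h => ?_
  rw [← tsum_mul_left, ← (Equiv.mulLeft h).tsum_eq]
  refine tsum_congr fun δ => ?_
  rw [Equiv.coe_mulLeft, inv_mul_cancel_left, mul_smul, mul_ite, mul_zero]
  simp only [smul_eq_iff_eq_inv_smul]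

variable (p Γ Q) in
/-- The linear extension of the permutation representation of `Γ` on a finite `Γ`-set. -/
def permRep : CZero p Γ →+* Matrix Q Q ℚ_[p] where
  toFun x := Matrix.of fun a b => ∑' γ : Γ, if γ • b = a then x.coeff γ else 0
  map_zero' := by ext a b; simp
  map_add' x y := by
    ext a b
    rw [Matrix.of_apply, Matrix.add_apply, Matrix.of_apply, Matrix.of_apply,
      ← (summable_ite x _).tsum_add (summable_ite y _)]
    refine tsum_congr fun γ => ?_
    split_ifs <;> simp
  map_one' := by
    classical
    ext a b
    rw [Matrix.of_apply, tsum_eq_single 1]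
    · simp [coeff_one_ite, Matrix.one_apply, eq_comm]
    · intro γ hγ
      simp [coeff_one_ite, hγ]
  map_mul' x y := by
    ext a c
    rw [Matrix.of_apply, tsum_ite_mul, Matrix.mul_apply]
    simp only [Matrix.of_apply]
    have h1 : ∀ b : Q, (∑' γ : Γ, if γ • b = a then x.coeff γ else 0) *
        (∑' δ : Γ, if δ • c = b then y.coeff δ else 0) =
        ∑' γ : Γ, (if γ • b = a then x.coeff γ else 0) *
          (∑' δ : Γ, if δ • c = b then y.coeff δ else 0) := fun b => tsum_mul_right.symm
    simp_rw [h1]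
    rw [← Summable.tsum_finsetSum fun b _ => (summable_ite x _).mul_right _]
    refine tsum_congr fun γ => ?_
    -- The intermediate point `b` is determined by `γ • b = a`.
    rw [Finset.sum_eq_single (γ⁻¹ • a)]
    · simp
    · intro b _ hb
      rw [if_neg, zero_mul]
      rintro rfl
      simp at hb
    · simp

theorem permRep_apply (x : CZero p Γ) (a b : Q) :
    permRep p Γ Q x a b = ∑' γ : Γ, if γ • b = a then x.coeff γ else 0 := rfl

theorem permRep_smul (c : ℚ_[p]) (x : CZero p Γ) : permRep p Γ Q (c • x) = c • permRep p Γ Q x := by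
  ext a b
  rw [Matrix.smul_apply, permRep_apply, permRep_apply, smul_eq_mul, ← tsum_mul_left]
  refine tsum_congr fun γ => ?_
  simp

theorem norm_permRep_le (x : CZero p Γ) (a b : Q) : ‖permRep p Γ Q x a b‖ ≤ ‖x‖ :=
  norm_tsum_ite_le x _ (norm_nonneg _) fun γ _ => norm_coeff_le x γ

/-- Allows the representation to be applied termwise to the logarithmic series. -/
theorem continuous_permRep : Continuous (permRep p Γ Q) := by
  refine continuous_pi fun a => continuous_pi fun b => ?_
  let f : CZero p Γ →+ ℚ_[p] :=
    { toFun := fun x => permRep p Γ Q x a b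
      map_zero' := by simp
      map_add' := fun x y => by simp }
  refine AddMonoidHomClass.continuous_of_bound f 1 fun x => ?_
  rw [one_mul]
  exact norm_permRep_le x a b

variable (p Γ Q) in
/-- The representation `permRep` on matrices, with values in block matrices. -/
def permRepMatrix (r : ℕ) :
    Matrix (Fin r) (Fin r) (CZero p Γ) →+* Matrix (Fin r × Q) (Fin r × Q) ℚ_[p] :=
  (Matrix.compRingEquiv (Fin r) Q ℚ_[p]).toRingHom.comp (permRep p Γ Q).mapMatrix

theorem permRepMatrix_apply {r : ℕ} (x : Matrix (Fin r) (Fin r) (CZero p Γ)) (i j : Fin r × Q) :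
    permRepMatrix p Γ Q r x i j = permRep p Γ Q (x i.1 j.1) i.2 j.2 := rfl

theorem continuous_permRepMatrix (r : ℕ) : Continuous (permRepMatrix p Γ Q r) := by
  refine continuous_pi fun i => continuous_pi fun j => ?_
  exact (continuous_apply_apply i.2 j.2).comp
    (continuous_permRep.comp (continuous_apply_apply i.1 j.1))

theorem permRepMatrix_smul {r : ℕ} (c : ℚ_[p]) (x : Matrix (Fin r) (Fin r) (CZero p Γ)) :
    permRepMatrix p Γ Q r (c • x) = c • permRepMatrix p Γ Q r x := by
  ext i j
  rw [Matrix.smul_apply, permRepMatrix_apply, permRepMatrix_apply, Matrix.smul_apply, permRep_smul,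
    Matrix.smul_apply]

/-- By normality, `γ` fixes a coset `gN` exactly when `γ ∈ N`, whatever `g` is. -/
theorem permRep_quotient_diag (N : Subgroup Γ) [N.Normal] [Fintype (Γ ⧸ N)] [DecidableEq (Γ ⧸ N)]
    [DecidablePred (· ∈ N)] (x : CZero p Γ) (a : Γ ⧸ N) :
    permRep p Γ (Γ ⧸ N) x a a = ∑' γ, if γ ∈ N then x.coeff γ else 0 := by
  rw [permRep_apply]
  refine tsum_congr fun γ => ?_
  congr 1
  induction a using QuotientGroup.induction_on with
  | H g =>
    rw [MulAction.Quotient.smul_mk, eq_iff_iff, eq_comm, QuotientGroup.eq, smul_eq_mul]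
    rw [← mul_assoc]
    exact (Subgroup.Normal.mem_comm_iff ‹N.Normal›).trans (by rw [mul_inv_cancel_left])

theorem trace_permRepMatrix (N : Subgroup Γ) [N.Normal] [Fintype (Γ ⧸ N)] [DecidableEq (Γ ⧸ N)]
    [DecidablePred (· ∈ N)] {r : ℕ} (x : Matrix (Fin r) (Fin r) (CZero p Γ)) :
    (permRepMatrix p Γ (Γ ⧸ N) r x).trace =
      N.index * ∑' γ, if γ ∈ N then x.trace.coeff γ else 0 := by
  have h1 : ∀ i : Fin r × (Γ ⧸ N), (permRepMatrix p Γ (Γ ⧸ N) r x).diag i =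
      ∑' γ, if γ ∈ N then (x i.1 i.1).coeff γ else 0 := fun i => by
    rw [Matrix.diag_apply, permRepMatrix_apply, permRep_quotient_diag]
  have h2 : ∀ (s : Finset (Fin r)), ∑ i ∈ s, (∑' γ, if γ ∈ N then (x i i).coeff γ else 0) =
      ∑' γ, if γ ∈ N then (∑ i ∈ s, x i i).coeff γ else 0 := fun s => by
    induction s using Finset.induction_on with
    | empty => simp
    | insert i s hi ih =>
      rw [Finset.sum_insert hi, ih, ← (summable_ite _ _).tsum_add (summable_ite _ _)]
      refine tsum_congr fun γ => ?_
      rw [Finset.sum_insert hi]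
      split_ifs <;> simp
  rw [Matrix.trace, Finset.sum_congr rfl fun i _ => h1 i, Fintype.sum_prod_type]
  simp only [Finset.sum_const, Finset.card_univ, nsmul_eq_mul]
  rw [← Finset.mul_sum, h2, Subgroup.index_eq_card, Nat.card_eq_fintype_card]
  rfl

/-- Only finitely many coefficients have norm at least `ε / 2`, and each such `γ ≠ 1` lies in
finitely many `N n`. For large `n` all remaining terms with `γ ≠ 1` are small, and so is their sum
by the ultrametric inequality. -/
theorem tendsto_tsum_mem {N : ℕ → Subgroup Γ} (hN : TendsToIdentity N)
    [∀ n, DecidablePred (· ∈ N n)] (x : CZero p Γ) :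
    Tendsto (fun n => ∑' γ, if γ ∈ N n then x.coeff γ else 0) atTop (𝓝 (x.coeff 1)) := by
  classical
  rw [Metric.tendsto_atTop']
  intro ε hε
  have hfin : {γ | ¬ ‖x.coeff γ‖ < ε / 2}.Finite := by
    have h := x.tendsto_coeff.norm
    rw [norm_zero] at h
    exact h.eventually_lt_const (half_pos hε)
  have hev : ∀ᶠ n in atTop, ∀ γ ∈ {γ | ¬ ‖x.coeff γ‖ < ε / 2}, γ ≠ 1 → γ ∉ N n := by
    refine (eventually_all_finite hfin).2 fun γ _ => ?_
    by_cases hγ : γ = 1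
    · simp [hγ]
    · have h1 : {n | γ ∈ N n}.Finite := by
        by_contra h
        exact hγ (hN.eq_one γ h)
      rw [← Nat.cofinite_eq_atTop]
      filter_upwards [h1.compl_mem_cofinite] with n hn _
      exact hn
  obtain ⟨n₀, hn₀⟩ := eventually_atTop.1 hev
  refine ⟨n₀, fun n hn => ?_⟩
  have h1 : (∑' γ, if γ ∈ N n then x.coeff γ else 0) - x.coeff 1 =
      ∑' γ, if γ ∈ N n ∧ γ ≠ 1 then x.coeff γ else 0 := by
    rw [(summable_ite x _).tsum_eq_add_tsum_ite 1, if_pos (one_mem _), add_sub_cancel_left]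
    refine tsum_congr fun γ => ?_
    by_cases hγ : γ = 1 <;> simp [hγ]
  rw [dist_eq_norm, h1]
  refine (norm_tsum_ite_le x _ (half_pos hε).le fun γ hγ => ?_).trans_lt (half_lt_self hε)
  by_contra h
  exact hn₀ n hn.le γ (fun h' => h h'.le) hγ.2 hγ.1

end CZero

end PermutationRepresentation

/-! ### Homomorphisms out of `K₁` -/

noncomputable section KOneMaps

variable {R : Type*} [Ring R]

/-- The homomorphism on `K₁` given by a compatible family of homomorphisms on the groups `GL_n`
which are trivial on elementary matrices. -/
def KOne.lift {M : Type*} [CommGroup M] (φ : ∀ n : ℕ, GL (Fin n) R →* M)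
    (hstab : ∀ (m n : ℕ) (h : m ≤ n) (a : GL (Fin m) R), φ m a = φ n (stabGL R m n h a))
    (hel : ∀ (n : ℕ) (i j : Fin n) (c : R) (u : GL (Fin n) R), i ≠ j →
      (u : Matrix (Fin n) (Fin n) R) = 1 + Matrix.single i j c → φ n u = 1) : KOne R →* M :=
  QuotientGroup.lift (elementaryInf R)
    { toFun := DirectLimit.lift (stabGL R) (fun n a => φ n a) hstab
      map_one' := by
        rw [DirectLimit.one_def (f := stabGL R) 0, DirectLimit.lift_def, map_one]
      map_mul' := fun x y => by
        obtain ⟨n, a, b, rfl, rfl⟩ := DirectLimit.exists_eq_mk₂ (stabGL R) x y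
        rw [DirectLimit.mul_def, DirectLimit.lift_def, DirectLimit.lift_def, DirectLimit.lift_def,
          map_mul] }
    (by
      rw [elementaryInf, iSup_le_iff]
      intro n
      rw [Subgroup.map_le_iff_le_comap, elementaryGroup, Subgroup.closure_le]
      rintro u ⟨i, j, hij, c, hu⟩
      exact hel n i j c u hij hu)

theorem KOne.exists_mk (x : KOne R) : ∃ (n : ℕ) (a : GL (Fin n) R), x = KOne.mk a := by
  obtain ⟨y, rfl⟩ := QuotientGroup.mk'_surjective (elementaryInf R) x
  obtain ⟨n, a, rfl⟩ := DirectLimit.exists_eq_mk (stabGL R) y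
  exact ⟨n, a, rfl⟩

theorem KOne.mk_stab {m n : ℕ} (h : m ≤ n) (a : GL (Fin m) R) :
    KOne.mk (stabGL R m n h a) = KOne.mk a :=
  congrArg (QuotientGroup.mk' (elementaryInf R)) (GLInf.of_stab h a)

theorem KOne.mk_eq_one_of_mem {n : ℕ} {a : GL (Fin n) R} (ha : a ∈ elementaryGroup (Fin n) R) :
    KOne.mk a = 1 :=
  (QuotientGroup.eq_one_iff _).2 (Subgroup.mem_iSup_of_mem n (Subgroup.mem_map_of_mem _ ha))

variable (R) in
/-- A unit as a `1 × 1`-matrix. -/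
def scalarGL : Rˣ →* GL (Fin 1) R :=
  Units.map (Matrix.scalar (Fin 1) : R →+* Matrix (Fin 1) (Fin 1) R).toMonoidHom

theorem scalarGL_apply (u : Rˣ) (i j : Fin 1) :
    (scalarGL R u : Matrix (Fin 1) (Fin 1) R) i j = u := by
  rw [Subsingleton.elim i j]
  simp [scalarGL]

theorem KOne.mk_scalarGL (u : Rˣ) : KOne.mk (scalarGL R u) = KOne.ofUnit u := rfl

end KOneMaps

/-! ### Logarithmic determinants of permutation representations -/

noncomputable section PermutationDeterminant

open Filter Topology

variable {p : ℕ} [hp : Fact p.Prime] {Γ : Type*} [Group Γ]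

theorem Matrix.coePadic_injective {m : Type*} [Fintype m] [DecidableEq m] :
    Function.Injective (Matrix.coePadic : Matrix m m ℤ_[p] →+* Matrix m m ℚ_[p]) :=
  Matrix.map_injective Subtype.val_injective

namespace CZeroInt

/-- The inclusion `M_r(c₀(Γ, ℤ_p)) → M_r(c₀(Γ))`. -/
def coeMatrix (r : ℕ) :
    Matrix (Fin r) (Fin r) (CZeroInt p Γ) →+* Matrix (Fin r) (Fin r) (CZero p Γ) :=
  (CZeroInt p Γ).subtype.mapMatrix

theorem norm_coe_pow_le {r : ℕ} (a : Matrix (Fin r) (Fin r) (CZeroInt p Γ)) (k : ℕ)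
    (i j : Fin r) : ‖coeMatrix r ((p • a) ^ k) i j‖ ≤ ((p : ℝ)⁻¹) ^ k := by
  have h : coeMatrix r ((p • a) ^ k) i j =
      ((p : ℚ_[p]) ^ k) • (((a ^ k) i j : CZeroInt p Γ) : CZero p Γ) := by
    rw [smul_pow, map_nsmul, Matrix.smul_apply, ← Nat.cast_pow, Nat.cast_smul_eq_nsmul]
    rfl
  rw [h]
  refine (CZero.norm_smul_le' _ _).trans ?_
  rw [norm_pow, norm_natCast_prime]
  exact mul_le_of_le_one_right (by positivity) (Real.iSup_le ((a ^ k) i j).2 zero_le_one)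

theorem summable_log {r : ℕ} (a : Matrix (Fin r) (Fin r) (CZeroInt p Γ)) : Summable fun k : ℕ =>
    ((k + 1 : ℕ) : ℚ_[p])⁻¹ • (1 - coeMatrix r (1 + p • a)) ^ (k + 1) := by
  refine Pi.summable.2 fun i => Pi.summable.2 fun j =>
    Summable.of_norm_bounded (summable_log_bound (p := p)) fun k => ?_
  refine norm_log_term_le CZero.norm_smul_le' k ?_
  rw [map_add, map_one, sub_add_cancel_left, ← map_neg, ← map_pow, ← smul_neg]
  exact norm_coe_pow_le _ _ _ _

section Representation

variable {Q : Type*} [Fintype Q] [DecidableEq Q] [MulAction Γ Q]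

theorem norm_permRep_le_one (x : CZeroInt p Γ) (a b : Q) :
    ‖CZero.permRep p Γ Q (x : CZero p Γ) a b‖ ≤ 1 :=
  CZero.norm_tsum_ite_le _ _ zero_le_one fun γ _ => x.2 γ

variable (p Γ Q) in
/-- The permutation representation on a finite `Γ`-set, with coefficients in `ℤ_p`. -/
def permRep : CZeroInt p Γ →+* Matrix Q Q ℤ_[p] where
  toFun x := Matrix.of fun a b => ⟨CZero.permRep p Γ Q (x : CZero p Γ) a b, norm_permRep_le_one x a b⟩
  map_zero' := Matrix.coePadic_injective (map_zero (CZero.permRep p Γ Q))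
  map_add' x y := Matrix.coePadic_injective (by
    rw [map_add]; exact map_add (CZero.permRep p Γ Q) (x : CZero p Γ) y)
  map_one' := Matrix.coePadic_injective (by
    rw [map_one]; exact map_one (CZero.permRep p Γ Q))
  map_mul' x y := Matrix.coePadic_injective (by
    rw [map_mul]; exact map_mul (CZero.permRep p Γ Q) (x : CZero p Γ) y)

variable (p Γ Q) in
/-- The representation `permRep` on matrices, with values in block matrices. -/
def permRepMatrix (r : ℕ) :
    Matrix (Fin r) (Fin r) (CZeroInt p Γ) →+* Matrix (Fin r × Q) (Fin r × Q) ℤ_[p] :=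
  (Matrix.compRingEquiv (Fin r) Q ℤ_[p]).toRingHom.comp (permRep p Γ Q).mapMatrix

theorem permRepMatrix_apply {r : ℕ} (x : Matrix (Fin r) (Fin r) (CZeroInt p Γ)) (i j : Fin r × Q) :
    permRepMatrix p Γ Q r x i j = permRep p Γ Q (x i.1 j.1) i.2 j.2 := rfl

theorem coePadic_permRepMatrix {r : ℕ} (x : Matrix (Fin r) (Fin r) (CZeroInt p Γ)) :
    Matrix.coePadic (permRepMatrix p Γ Q r x) = CZero.permRepMatrix p Γ Q r (coeMatrix r x) := rfl

variable (p Γ Q) in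
/-- The determinant of the permutation representation. -/
def permDet (r : ℕ) : GL (Fin r) (CZeroInt p Γ) →* ℤ_[p]ˣ :=
  Units.map (Matrix.detMonoidHom.comp (permRepMatrix p Γ Q r).toMonoidHom)

theorem coe_permDet {r : ℕ} (g : GL (Fin r) (CZeroInt p Γ)) :
    (permDet p Γ Q r g : ℤ_[p]) =
      (permRepMatrix p Γ Q r (g : Matrix (Fin r) (Fin r) (CZeroInt p Γ))).det := rfl

theorem permDet_stab {m n : ℕ} (h : m ≤ n) (g : GL (Fin m) (CZeroInt p Γ)) :
    permDet p Γ Q n (stabGL _ m n h g) = permDet p Γ Q m g := by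
  obtain ⟨k, rfl⟩ := Nat.exists_eq_add_of_le h
  apply Units.ext
  rw [coe_permDet, coe_permDet, coe_stabGL, stabMatrix_add]
  let e : (Fin m × Q) ⊕ (Fin k × Q) ≃ Fin (m + k) × Q :=
    (Equiv.sumProdDistrib _ _ _).symm.trans (finSumFinEquiv.prodCongr (Equiv.refl Q))
  rw [← Matrix.det_submatrix_equiv_self e]
  have : (permRepMatrix p Γ Q (m + k) (Matrix.reindexAlgEquiv ℤ (CZeroInt p Γ) finSumFinEquiv
      (Matrix.fromBlocks (g : Matrix (Fin m) (Fin m) (CZeroInt p Γ)) 0 0 1))).submatrix e e =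
      Matrix.fromBlocks (permRepMatrix p Γ Q m (g : Matrix (Fin m) (Fin m) (CZeroInt p Γ))) 0 0 1 := by
    ext (⟨i, a⟩ | ⟨i, a⟩) (⟨j, b⟩ | ⟨j, b⟩)
    · simp [e, permRepMatrix_apply]
    · simp [e, permRepMatrix_apply]
    · simp [e, permRepMatrix_apply]
    · by_cases hij : i = j <;> simp [e, permRepMatrix_apply, Matrix.one_apply, hij]
  rw [this, Matrix.det_fromBlocks_zero₂₁, Matrix.det_one, mul_one]

/-- The image of `single i j c` factors as `U * V` through a single block, with `V * U = 0` because
`i ≠ j`; hence `det (1 + UV) = det (1 + VU) = 1`. -/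
theorem permDet_elementary {n : ℕ} {i j : Fin n} {c : CZeroInt p Γ} {u : GL (Fin n) (CZeroInt p Γ)}
    (hij : i ≠ j) (hu : (u : Matrix (Fin n) (Fin n) (CZeroInt p Γ)) = 1 + Matrix.single i j c) :
    permDet p Γ Q n u = 1 := by
  apply Units.ext
  rw [coe_permDet, hu, map_add, map_one, Units.val_one]
  let U : Matrix (Fin n × Q) Q ℤ_[p] := Matrix.of fun x b => if i = x.1 then permRep p Γ Q c x.2 b else 0
  let V : Matrix Q (Fin n × Q) ℤ_[p] := Matrix.of fun b y => if j = y.1 ∧ b = y.2 then 1 else 0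
  have h1 : permRepMatrix p Γ Q n (Matrix.single i j c) = U * V := by
    ext ⟨k, a⟩ ⟨l, b⟩
    rw [permRepMatrix_apply, Matrix.mul_apply]
    by_cases hk : i = k <;> by_cases hl : j = l <;> simp [U, V, hk, hl]
  have h2 : V * U = 0 := by
    ext a b
    rw [Matrix.mul_apply]
    refine Finset.sum_eq_zero fun x _ => ?_
    by_cases hi : i = x.1
    · have : ¬ j = x.1 := fun h => hij (hi.trans h.symm)
      simp [V, this]
    · simp [U, hi]
  rw [h1, Matrix.det_one_add_mul_comm, h2, add_zero, Matrix.det_one]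

variable (p Γ Q) in
/-- The homomorphism `log_p det` on `K₁(c₀(Γ, ℤ_p))` coming from a finite `Γ`-set. -/
def permLogDet : KOne (CZeroInt p Γ) →* Multiplicative ℚ_[p] :=
  KOne.lift (fun n => (unitLog p).comp (permDet p Γ Q n))
    (fun m n h a => by rw [MonoidHom.comp_apply, MonoidHom.comp_apply, permDet_stab])
    (fun n i j c u hij hu => by rw [MonoidHom.comp_apply, permDet_elementary hij hu, map_one])

theorem permLogDet_mk {n : ℕ} (g : GL (Fin n) (CZeroInt p Γ)) :
    permLogDet p Γ Q (KOne.mk g) = unitLog p (permDet p Γ Q n g) := rfl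

theorem logSeries_permRepMatrix {r : ℕ} (a : Matrix (Fin r) (Fin r) (CZeroInt p Γ)) :
    logSeries p (Matrix.coePadic (permRepMatrix p Γ Q r (1 + p • a))) =
      CZero.permRepMatrix p Γ Q r (logSeries p (coeMatrix r (1 + p • a))) := by
  rw [logSeries, logSeries, map_neg,
    (summable_log a).map_tsum (CZero.permRepMatrix p Γ Q r) (CZero.continuous_permRepMatrix r)]
  congr 1
  refine tsum_congr fun k => ?_
  rw [CZero.permRepMatrix_smul, map_pow, map_sub, map_one, coePadic_permRepMatrix]

theorem permLogDet_one_unit {r : ℕ} {g : GL (Fin r) (CZeroInt p Γ)}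
    {a : Matrix (Fin r) (Fin r) (CZeroInt p Γ)}
    (hg : (g : Matrix (Fin r) (Fin r) (CZeroInt p Γ)) = 1 + p • a) :
    (permLogDet p Γ Q (KOne.mk g)).toAdd = (CZero.permRepMatrix p Γ Q r
      (logSeries p (coeMatrix r (g : Matrix (Fin r) (Fin r) (CZeroInt p Γ))))).trace := by
  have h := logSeries_det (permRepMatrix p Γ Q r a)
  have h1 : (permDet p Γ Q r g : ℤ_[p]) = (1 + p • permRepMatrix p Γ Q r a).det := by
    rw [coe_permDet, hg, map_add, map_one, map_nsmul]
  rw [permLogDet_mk, unitLog_of_one_unit (h1 ▸ h.1), h1, h.2, hg, ← logSeries_permRepMatrix,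
    map_add (permRepMatrix p Γ Q r), map_one, map_nsmul (permRepMatrix p Γ Q r)]

end Representation

theorem permRep_ofGroup_of_mem (N : Subgroup Γ) [N.Normal] [Fintype (Γ ⧸ N)] [DecidableEq (Γ ⧸ N)]
    {γ : Γ} (hγ : γ ∈ N) : permRep p Γ (Γ ⧸ N) (ofGroup p γ : CZeroInt p Γ) = 1 := by
  classical
  apply Matrix.coePadic_injective
  ext a b
  rw [map_one]
  change CZero.permRep p Γ (Γ ⧸ N) (CZero.single γ) a b = _
  rw [CZero.permRep_apply, tsum_eq_single γ]
  · have h : γ • b = b := by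
      induction b using QuotientGroup.induction_on with
      | H g =>
        rw [MulAction.Quotient.smul_mk, eq_comm, QuotientGroup.eq, smul_eq_mul]
        exact (Subgroup.Normal.mem_comm_iff ‹N.Normal›).2 (by rwa [mul_assoc, mul_inv_cancel, mul_one])
    simp [CZero.coeff_single, h, Matrix.one_apply, eq_comm]
  · intro δ hδ
    simp [CZero.coeff_single, hδ]

/-- `γ ^ N.index` lies in `N` and acts trivially on `Γ ⧸ N`; since `ℚ_p` is torsion-free, the value
at `γ` itself vanishes. -/
theorem permLogDet_ofGroup (N : Subgroup Γ) [N.Normal] [N.FiniteIndex] [Fintype (Γ ⧸ N)]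
    [DecidableEq (Γ ⧸ N)] (γ : Γ) :
    permLogDet p Γ (Γ ⧸ N) (KOne.ofUnit (ofGroup p γ)) = 1 := by
  have h1 : permLogDet p Γ (Γ ⧸ N) (KOne.ofUnit (ofGroup p (γ ^ N.index))) = 1 := by
    rw [← KOne.mk_scalarGL, permLogDet_mk, ← map_one (unitLog p)]
    congr 1
    apply Units.ext
    rw [coe_permDet, Units.val_one, ← Matrix.det_one (n := Fin 1 × (Γ ⧸ N)) (R := ℤ_[p])]
    congr 1
    ext ⟨i, a⟩ ⟨j, b⟩
    rw [permRepMatrix_apply, scalarGL_apply, Subsingleton.elim i j,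
      permRep_ofGroup_of_mem N (Subgroup.pow_index_mem N γ)]
    simp [Matrix.one_apply]
  rw [map_pow, map_pow, map_pow] at h1
  have h' := congrArg Multiplicative.toAdd h1
  rw [toAdd_pow, toAdd_one, smul_eq_zero] at h'
  exact Multiplicative.toAdd.injective (h'.resolve_left Subgroup.FiniteIndex.index_ne_zero)

/-- The index cancels against the one in the trace formula, leaving the sum over `N n` of the
coefficients of `tr log g`. -/
theorem tendsto_permLogDet_one_unit {N : ℕ → Subgroup Γ} (hN : TendsToIdentity N)
    [∀ n, Fintype (Γ ⧸ N n)] [∀ n, DecidableEq (Γ ⧸ N n)] {r : ℕ} {g : GL (Fin r) (CZeroInt p Γ)}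
    (hg : ∃ a : Matrix (Fin r) (Fin r) (CZeroInt p Γ),
      (g : Matrix (Fin r) (Fin r) (CZeroInt p Γ)) = 1 + p • a) :
    Tendsto (fun n => ((N n).index : ℚ_[p])⁻¹ * (permLogDet p Γ (Γ ⧸ N n) (KOne.mk g)).toAdd) atTop
      (𝓝 (logDetOneUnit p (g : Matrix (Fin r) (Fin r) (CZeroInt p Γ)))) := by
  classical
  obtain ⟨a, ha⟩ := hg
  refine (CZero.tendsto_tsum_mem hN (logSeries p (coeMatrix r
    (g : Matrix (Fin r) (Fin r) (CZeroInt p Γ)))).trace).congr fun n => ?_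
  have := hN.normal n
  have hne : ((N n).index : ℚ_[p]) ≠ 0 := by
    exact_mod_cast (hN.finiteIndex n).index_ne_zero
  rw [permLogDet_one_unit ha, CZero.trace_permRepMatrix, inv_mul_cancel_left₀ hne]

end CZeroInt

end PermutationDeterminant

/-! ### The kernel of `K₁` under a surjection of rings -/

noncomputable section KOneReduction

variable {R S : Type*} [Ring R] [Ring S]

/-- The map induced on `GL_n` by a ring homomorphism. -/
def glMap (f : R →+* S) (n : ℕ) : GL (Fin n) R →* GL (Fin n) S :=
  Units.map f.mapMatrix.toMonoidHom

theorem coe_glMap (f : R →+* S) {n : ℕ} (u : GL (Fin n) R) :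
    (glMap f n u : Matrix (Fin n) (Fin n) S) = (u : Matrix (Fin n) (Fin n) R).map f := rfl

theorem glMap_stab (f : R →+* S) {m n : ℕ} (h : m ≤ n) (u : GL (Fin m) R) :
    glMap f n (stabGL R m n h u) = stabGL S m n h (glMap f m u) := by
  apply Units.ext
  rw [coe_glMap, coe_stabGL, coe_stabGL, coe_glMap]
  ext i j
  simp only [stabMatrix, Matrix.map_apply, Matrix.of_apply]
  split_ifs <;> simp

theorem stabGL_mem_elementaryGroup {m n : ℕ} (h : m ≤ n) {u : GL (Fin m) R}
    (hu : u ∈ elementaryGroup (Fin m) R) : stabGL R m n h u ∈ elementaryGroup (Fin n) R := by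
  have : elementaryGroup (Fin m) R ≤ (elementaryGroup (Fin n) R).comap (stabGL R m n h) := by
    refine (Subgroup.closure_le _).2 ?_
    rintro v ⟨i, j, hij, c, hv⟩
    refine Subgroup.subset_closure ⟨Fin.castLE h i, Fin.castLE h j, by simpa using hij, c, ?_⟩
    rw [coe_stabGL, hv]
    ext k l
    simp only [stabMatrix, Matrix.of_apply, Matrix.add_apply, Matrix.one_apply, Matrix.single_apply,
      Fin.ext_iff, Fin.val_castLE]
    split_ifs <;> first | omega | simp
  exact this hu

/-- `E_∞` is a directed union and `GL_∞` a direct limit, so membership is already visible at a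
finite stage. -/
theorem exists_stabGL_mem_elementaryGroup {n : ℕ} {u : GL (Fin n) R} (hu : KOne.mk u = 1) :
    ∃ (m : ℕ) (h : n ≤ m), stabGL R n m h u ∈ elementaryGroup (Fin m) R := by
  have h1 : GLInf.of R n u ∈ elementaryInf R := (QuotientGroup.eq_one_iff _).1 hu
  rw [elementaryInf, Subgroup.mem_iSup_of_directed] at h1
  · obtain ⟨m, e, he, heq⟩ := h1
    obtain ⟨k, hmk, hnk, hk⟩ := Quotient.exact heq
    refine ⟨k, hnk, ?_⟩
    have hk' : stabGL R m k hmk e = stabGL R n k hnk u := hk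
    rw [← hk']
    exact stabGL_mem_elementaryGroup hmk he
  · refine Monotone.directed_le fun m k hmk => ?_
    rw [Subgroup.map_le_iff_le_comap]
    intro e he
    exact ⟨_, stabGL_mem_elementaryGroup hmk he, GLInf.of_stab hmk e⟩

/-- The elementary matrix `1 + c e_ij`. -/
def elementaryGL {ι : Type*} [Fintype ι] [DecidableEq ι] {i j : ι} (hij : i ≠ j) (c : R) :
    GL ι R where
  val := 1 + Matrix.single i j c
  inv := 1 - Matrix.single i j c
  val_inv := by simp [mul_sub, add_mul, hij.symm]
  inv_val := by simp [sub_mul, mul_add, hij.symm]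

theorem exists_mem_elementaryGroup_glMap_eq {f : R →+* S} (hf : Function.Surjective f) {n : ℕ}
    {u : GL (Fin n) S} (hu : u ∈ elementaryGroup (Fin n) S) :
    ∃ v ∈ elementaryGroup (Fin n) R, glMap f n v = u := by
  have : elementaryGroup (Fin n) S ≤ (elementaryGroup (Fin n) R).map (glMap f n) := by
    refine (Subgroup.closure_le _).2 ?_
    rintro v ⟨i, j, hij, c, hv⟩
    obtain ⟨d, rfl⟩ := hf c
    refine ⟨elementaryGL hij d, Subgroup.subset_closure ⟨i, j, hij, d, rfl⟩, Units.ext ?_⟩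
    rw [hv, coe_glMap]
    change f.mapMatrix (1 + Matrix.single i j d) = _
    rw [map_add, map_one]
    simp
  exact this hu

/-- An element in the kernel of `K₁(R) → K₁(S)` comes from a matrix which becomes trivial over
`S`. -/
theorem exists_glMap_eq_one_of_mk_eq_one {f : R →+* S} (hf : Function.Surjective f) {n : ℕ}
    {u : GL (Fin n) R} (hu : KOne.mk (glMap f n u) = 1) :
    ∃ (m : ℕ) (g : GL (Fin m) R), glMap f m g = 1 ∧ KOne.mk u = KOne.mk g := by
  obtain ⟨m, h, hm⟩ := exists_stabGL_mem_elementaryGroup hu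
  obtain ⟨v, hv, hvu⟩ := exists_mem_elementaryGroup_glMap_eq hf hm
  -- Dividing by an elementary lift `v` of the reduction of `u` does not change the class and makes
  -- the reduction trivial.
  refine ⟨m, v⁻¹ * stabGL R n m h u, ?_, ?_⟩
  · rw [map_mul, map_inv, hvu, glMap_stab, inv_mul_cancel]
  · rw [map_mul, map_inv, KOne.mk_eq_one_of_mem hv, inv_one, one_mul, KOne.mk_stab]

end KOneReduction

/-! ### Reduction modulo `p` and the torsion hypothesis -/

noncomputable section Reduction

open Filter Topology

variable {p : ℕ} [hp : Fact p.Prime] {Γ : Type*} [Group Γ]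

theorem PadicInt.toZMod_eq_zero_iff (z : ℤ_[p]) : PadicInt.toZMod z = 0 ↔ ‖z‖ < 1 := by
  rw [← RingHom.mem_ker, PadicInt.ker_toZMod, IsLocalRing.mem_maximalIdeal, PadicInt.mem_nonunits]

/-- The valuation is discrete. The uniform bound is what passes to infinite sums, where a strict
inequality need not. -/
theorem PadicInt.norm_le_inv_of_lt_one {z : ℤ_[p]} (hz : ‖z‖ < 1) : ‖z‖ ≤ (p : ℝ)⁻¹ := by
  obtain ⟨w, rfl⟩ := (PadicInt.norm_lt_one_iff_dvd z).1 hz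
  rw [norm_mul, PadicInt.norm_p]
  exact mul_le_of_le_one_right (by positivity) (PadicInt.norm_le_one _)

namespace CZeroInt

/-- The coefficients in `ℤ_p` of an element of `c₀(Γ, ℤ_p)`. -/
def coeffInt (x : CZeroInt p Γ) (γ : Γ) : ℤ_[p] := ⟨(x : CZero p Γ).coeff γ, x.2 γ⟩

theorem coe_coeffInt (x : CZeroInt p Γ) (γ : Γ) : (coeffInt x γ : ℚ_[p]) = (x : CZero p Γ).coeff γ := rfl

theorem finite_support_toZMod (x : CZeroInt p Γ) :
    (Function.support fun γ => PadicInt.toZMod (coeffInt x γ)).Finite := by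
  have h := (x : CZero p Γ).tendsto_coeff.norm
  rw [norm_zero] at h
  refine (show {γ | ¬ ‖(x : CZero p Γ).coeff γ‖ < 1}.Finite from
    h.eventually_lt_const zero_lt_one).subset fun γ hγ => ?_
  exact fun h' => hγ ((PadicInt.toZMod_eq_zero_iff _).2 h')

/-- Outside `s` every term of the convolution has norm at most `1 / p`, so the infinite remainder
vanishes modulo `p`. This makes the reduction to `𝔽_p[Γ]` multiplicative. -/
theorem toZMod_coeff_mul (x y : CZeroInt p Γ) (γ : Γ) (s : Finset Γ)
    (hs : ∀ δ, δ ∉ s → PadicInt.toZMod (coeffInt x δ) = 0) :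
    PadicInt.toZMod (coeffInt (x * y) γ) =
      ∑ δ ∈ s, PadicInt.toZMod (coeffInt x δ) * PadicInt.toZMod (coeffInt y (δ⁻¹ * γ)) := by
  classical
  simp_rw [← map_mul]
  rw [← map_sum, ← sub_eq_zero, ← map_sub, PadicInt.toZMod_eq_zero_iff]
  have hsum := CZero.summable_conv_apply (x : CZero p Γ) (y : CZero p Γ) γ
  have h1 : ((coeffInt (x * y) γ - ∑ δ ∈ s, coeffInt x δ * coeffInt y (δ⁻¹ * γ) : ℤ_[p]) : ℚ_[p]) =
      ∑' δ : Γ, if δ ∈ s then 0 else (coeffInt x δ : ℚ_[p]) * coeffInt y (δ⁻¹ * γ) := by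
    have h2 : ∑ δ ∈ s, (coeffInt x δ : ℚ_[p]) * (coeffInt y (δ⁻¹ * γ) : ℚ_[p]) =
        ∑' δ : Γ, if δ ∈ s then (coeffInt x δ : ℚ_[p]) * coeffInt y (δ⁻¹ * γ) else 0 := by
      rw [tsum_eq_sum (s := s) fun δ hδ => if_neg hδ]
      exact Finset.sum_congr rfl fun δ hδ => (if_pos hδ).symm
    have h3 : Summable fun δ : Γ =>
        if δ ∈ s then (coeffInt x δ : ℚ_[p]) * coeffInt y (δ⁻¹ * γ) else 0 :=
      summable_of_ne_finset_zero (s := s) fun δ hδ => if_neg hδ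
    rw [PadicInt.coe_sub, PadicInt.coe_sum]
    simp only [PadicInt.coe_mul]
    rw [h2, coe_coeffInt, Subring.coe_mul, CZero.coeff_mul, ← hsum.tsum_sub h3]
    refine tsum_congr fun δ => ?_
    split_ifs
    · rw [coe_coeffInt, coe_coeffInt, sub_self]
    · rw [coe_coeffInt, coe_coeffInt, sub_zero]
  rw [PadicInt.norm_def, h1]
  refine (IsUltrametricDist.norm_tsum_le_of_forall_le_of_nonneg (C := (p : ℝ)⁻¹)
    (by positivity) fun δ => ?_).trans_lt (inv_lt_one_of_one_lt₀ (by exact_mod_cast hp.out.one_lt))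
  split_ifs with hδ
  · simp
  · rw [norm_mul]
    refine (mul_le_of_le_one_right (norm_nonneg _) (PadicInt.norm_le_one _)).trans ?_
    exact PadicInt.norm_le_inv_of_lt_one ((PadicInt.toZMod_eq_zero_iff _).1 (hs δ hδ))

theorem toZMod_coeff_one [DecidableEq Γ] (γ : Γ) :
    PadicInt.toZMod (coeffInt (1 : CZeroInt p Γ) γ) = if γ = 1 then 1 else 0 := by
  have : coeffInt (1 : CZeroInt p Γ) γ = if γ = 1 then 1 else 0 := by
    apply Subtype.ext
    change (1 : CZero p Γ).coeff γ = _
    rw [CZero.coeff_one_ite]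
    split_ifs <;> rfl
  rw [this]
  split_ifs <;> simp

variable (p Γ) in
/-- The reduction `c₀(Γ, ℤ_p) → 𝔽_p[Γ]`. -/
def reduction : CZeroInt p Γ →+* MonoidAlgebra (ZMod p) Γ where
  toFun x := .ofCoeff (Finsupp.ofSupportFinite _ (finite_support_toZMod x))
  map_zero' := by
    ext γ
    exact map_zero PadicInt.toZMod
  map_add' x y := by
    ext γ
    exact map_add PadicInt.toZMod (coeffInt x γ) (coeffInt y γ)
  map_one' := by
    classical
    ext γ
    refine (toZMod_coeff_one γ).trans ?_
    rw [MonoidAlgebra.one_def, MonoidAlgebra.coeff_single, Finsupp.single_apply]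
    simp only [eq_comm]
  map_mul' x y := by
    classical
    ext γ
    refine (toZMod_coeff_mul x y γ (finite_support_toZMod x).toFinset fun δ hδ => by
      simpa using hδ).trans ?_
    rw [MonoidAlgebra.coeff_mul_apply_left, Finsupp.sum]
    rfl

theorem coeff_reduction (x : CZeroInt p Γ) (γ : Γ) :
    (reduction p Γ x).coeff γ = PadicInt.toZMod (coeffInt x γ) := rfl

theorem reduction_surjective : Function.Surjective (reduction p Γ) := by
  intro c
  refine ⟨⟨⟨fun γ => ((c.coeff γ).val : ℚ_[p]), ?_⟩, fun γ => ?_⟩, ?_⟩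
  · refine tendsto_nhds_of_eventually_eq ?_
    filter_upwards [c.coeff.support.finite_toSet.compl_mem_cofinite] with γ hγ
    have : c.coeff γ = 0 := by simpa using hγ
    simp [this]
  · exact_mod_cast Padic.norm_int_le_one (p := p) ((c.coeff γ).val : ℤ)
  · ext γ
    rw [coeff_reduction]
    refine (congrArg PadicInt.toZMod (Subtype.ext ?_ : _ = ((c.coeff γ).val : ℤ_[p]))).trans ?_
    · rfl
    · rw [map_natCast, ZMod.natCast_zmod_val]

theorem exists_eq_smul_of_reduction_eq_zero {x : CZeroInt p Γ} (hx : reduction p Γ x = 0) :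
    ∃ y : CZeroInt p Γ, x = p • y := by
  have hp0 : (p : ℚ_[p]) ≠ 0 := by exact_mod_cast hp.out.ne_zero
  refine ⟨⟨(p : ℚ_[p])⁻¹ • (x : CZero p Γ), fun γ => ?_⟩, ?_⟩
  · have h : ‖coeffInt x γ‖ < 1 := by
      rw [← PadicInt.toZMod_eq_zero_iff, ← coeff_reduction, hx]
      rfl
    rw [CZero.coeff_smul, norm_mul, norm_inv, norm_natCast_prime, inv_inv]
    have h1 : ‖(x : CZero p Γ).coeff γ‖ ≤ (p : ℝ)⁻¹ := PadicInt.norm_le_inv_of_lt_one h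
    have h2 : (0 : ℝ) < p := by exact_mod_cast hp.out.pos
    calc (p : ℝ) * ‖(x : CZero p Γ).coeff γ‖ ≤ p * (p : ℝ)⁻¹ := by gcongr
      _ = 1 := mul_inv_cancel₀ h2.ne'
  · apply Subtype.ext
    change _ = p • ((p : ℚ_[p])⁻¹ • (x : CZero p Γ))
    rw [← Nat.cast_smul_eq_nsmul ℚ_[p], smul_smul, mul_inv_cancel₀ hp0, one_smul]

theorem reduction_ofGroup (γ : Γ) : reduction p Γ (ofGroup p γ : CZeroInt p Γ) =
    MonoidAlgebra.of (ZMod p) Γ γ := by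
  classical
  ext δ
  rw [coeff_reduction, MonoidAlgebra.of_apply, MonoidAlgebra.coeff_single, Finsupp.single_apply]
  have : coeffInt (ofGroup p γ : CZeroInt p Γ) δ = if γ = δ then 1 else 0 := by
    apply Subtype.ext
    change (CZero.single γ : CZero p Γ).coeff δ = _
    rw [CZero.coeff_single]
    by_cases h : δ = γ
    · rw [if_pos h, if_pos h.symm]; rfl
    · rw [if_neg h, if_neg (Ne.symm h)]; rfl
  rw [this]
  split_ifs <;> simp

/-- If `Wh^{𝔽_p}(Γ)` is torsion, then every class in `K₁(c₀(Γ, ℤ_p))` has a power which is the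
product of the class of an element of `Γ` and the class of a matrix `≡ 1 mod p`. -/
theorem exists_pow_eq_of_whitehead_torsion (hWh : IsMulTorsion (WhiteheadGroup p Γ))
    (x : KOne (CZeroInt p Γ)) :
    ∃ k : ℕ, k ≠ 0 ∧ ∃ (γ : Γ) (r : ℕ) (g : GL (Fin r) (CZeroInt p Γ)),
      (∃ a : Matrix (Fin r) (Fin r) (CZeroInt p Γ),
        (g : Matrix (Fin r) (Fin r) (CZeroInt p Γ)) = 1 + p • a) ∧
      x ^ k = KOne.mk g * KOne.ofUnit (ofGroup p γ) := by
  obtain ⟨n, F, rfl⟩ := KOne.exists_mk x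
  obtain ⟨k, hk, hpow⟩ := (isOfFinOrder_iff_pow_eq_one.1
    (hWh (QuotientGroup.mk (KOne.mk (glMap (reduction p Γ) n F)))))
  rw [← QuotientGroup.mk_pow, QuotientGroup.eq_one_iff] at hpow
  obtain ⟨γ, hγ⟩ := hpow
  let s : GL (Fin 1) (CZeroInt p Γ) := scalarGL _ (ofGroup p γ)
  have hs : KOne.mk (glMap (reduction p Γ) 1 s) = KOne.mk (glMap (reduction p Γ) n F) ^ k := by
    rw [← hγ]
    refine congrArg KOne.mk (a₂ := scalarGL _ _) (Units.ext ?_)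
    ext i j : 1
    rw [scalarGL_apply, coe_glMap, Matrix.map_apply, scalarGL_apply, reduction_ofGroup]
    rfl
  have h1 : 1 ≤ max n 1 := le_max_right _ _
  have h2 : n ≤ max n 1 := le_max_left _ _
  -- `F` has size `n` and `s` has size `1`; both are stabilized to a common size before forming `F ^
  -- k s⁻¹`, whose reduction is trivial in `K₁(𝔽_p[Γ])`.
  obtain ⟨m, g, hg, hmk⟩ := exists_glMap_eq_one_of_mk_eq_one (reduction_surjective (p := p) (Γ := Γ))
    (u := stabGL _ n _ h2 F ^ k * (stabGL _ 1 _ h1 s)⁻¹) (by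
      rw [map_mul, map_inv, map_pow, glMap_stab, glMap_stab, map_mul, map_inv, map_pow,
        KOne.mk_stab, KOne.mk_stab, hs, mul_inv_cancel])
  refine ⟨k, hk.ne', γ, m, g, ?_, ?_⟩
  · have h3 : ∀ i j, ∃ y : CZeroInt p Γ,
        ((g : Matrix (Fin m) (Fin m) (CZeroInt p Γ)) - 1) i j = p • y := fun i j => by
      apply exists_eq_smul_of_reduction_eq_zero
      have h4 : (reduction p Γ).mapMatrix (g : Matrix (Fin m) (Fin m) (CZeroInt p Γ)) = 1 :=
        congrArg Units.val hg
      have h5 : (reduction p Γ).mapMatrix ((g : Matrix (Fin m) (Fin m) (CZeroInt p Γ)) - 1) = 0 := by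
        rw [map_sub, h4, map_one, sub_self]
      exact congrFun (congrFun h5 i) j
    choose a ha using h3
    refine ⟨Matrix.of a, ?_⟩
    rw [← sub_eq_iff_eq_add']
    exact Matrix.ext ha
  · rw [← hmk, map_mul, map_inv, map_pow, KOne.mk_stab, KOne.mk_stab]
    exact (inv_mul_cancel_right _ _).symm

end CZeroInt

end Reduction

/-! ### Existence, uniqueness and limit formula for `log_p det_Γ` -/

noncomputable section LogDetExistence

open Filter Topology

variable {p : ℕ} [hp : Fact p.Prime] {Γ : Type*} [Group Γ]

theorem toAdd_pow_eq_mul {M : Type*} [Group M] (L : M →* Multiplicative ℚ_[p]) (x : M) (k : ℕ) :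
    (L (x ^ k)).toAdd = k * (L x).toAdd := by
  rw [map_pow, toAdd_pow, nsmul_eq_mul]

/-- The two characterizing properties determine the value on some positive power of each class, and
that exponent can be divided out in `ℚ_p`. -/
theorem IsLogDet.unique (hWh : IsMulTorsion (WhiteheadGroup p Γ))
    {L L' : KOne (CZeroInt p Γ) →* Multiplicative ℚ_[p]} (hL : IsLogDet p Γ L)
    (hL' : IsLogDet p Γ L') : L = L' := by
  refine MonoidHom.ext fun x => ?_
  obtain ⟨k, hk, γ, r, g, hg, hx⟩ := CZeroInt.exists_pow_eq_of_whitehead_torsion hWh x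
  have hk' : (k : ℚ_[p]) ≠ 0 := by exact_mod_cast hk
  have h : (L (x ^ k)).toAdd = (L' (x ^ k)).toAdd := by
    rw [hx, map_mul L, map_mul L', toAdd_mul, toAdd_mul, hL.1 r g hg, hL'.1 r g hg, hL.2, hL'.2]
  rw [toAdd_pow_eq_mul, toAdd_pow_eq_mul] at h
  exact Multiplicative.toAdd.injective ((mul_right_inj' hk').1 h)

/-- The group element in the decomposition of `x ^ k` contributes `0` for every `n`, so the limit is
that of the `1`-unit factor divided by `k`. -/
theorem exists_tendsto_permLogDet (hWh : IsMulTorsion (WhiteheadGroup p Γ)) {N : ℕ → Subgroup Γ}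
    (hN : TendsToIdentity N) [∀ n, Fintype (Γ ⧸ N n)] [∀ n, DecidableEq (Γ ⧸ N n)]
    (x : KOne (CZeroInt p Γ)) : ∃ l, Tendsto (fun n => ((N n).index : ℚ_[p])⁻¹ *
      (CZeroInt.permLogDet p Γ (Γ ⧸ N n) x).toAdd) atTop (𝓝 l) := by
  obtain ⟨k, hk, γ, r, g, hg, hx⟩ := CZeroInt.exists_pow_eq_of_whitehead_torsion hWh x
  have hk' : (k : ℚ_[p]) ≠ 0 := by exact_mod_cast hk
  refine ⟨(k : ℚ_[p])⁻¹ * logDetOneUnit p (g : Matrix (Fin r) (Fin r) (CZeroInt p Γ)),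
    ((CZeroInt.tendsto_permLogDet_one_unit hN hg).const_mul (k : ℚ_[p])⁻¹).congr fun n => ?_⟩
  have := hN.normal n
  have := hN.finiteIndex n
  have h := toAdd_pow_eq_mul (CZeroInt.permLogDet p Γ (Γ ⧸ N n)) x k
  rw [hx, map_mul, CZeroInt.permLogDet_ofGroup, mul_one] at h
  rw [h, mul_left_comm, inv_mul_cancel_left₀ hk']

/-- The homomorphism `log_p det_Γ` as a limit of the logarithms of the determinants of the
permutation representations on the sets `Γ ⧸ Γ_n`. -/
theorem exists_isLogDet_tendsto (hWh : IsMulTorsion (WhiteheadGroup p Γ)) {N : ℕ → Subgroup Γ}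
    (hN : TendsToIdentity N) [∀ n, Fintype (Γ ⧸ N n)] [∀ n, DecidableEq (Γ ⧸ N n)] :
    ∃ L : KOne (CZeroInt p Γ) →* Multiplicative ℚ_[p], IsLogDet p Γ L ∧
      ∀ x, Tendsto (fun n => ((N n).index : ℚ_[p])⁻¹ *
        (CZeroInt.permLogDet p Γ (Γ ⧸ N n) x).toAdd) atTop (𝓝 (L x).toAdd) := by
  choose l hl using exists_tendsto_permLogDet hWh hN
  let L : KOne (CZeroInt p Γ) →* Multiplicative ℚ_[p] := MonoidHom.mk' (fun x => .ofAdd (l x))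
    fun x y => by
      rw [← ofAdd_add]
      refine congrArg _ (tendsto_nhds_unique (hl (x * y)) (((hl x).add (hl y)).congr fun n => ?_))
      rw [map_mul, toAdd_mul, mul_add]
  refine ⟨L, ⟨fun r g hg => tendsto_nhds_unique (hl _)
    (CZeroInt.tendsto_permLogDet_one_unit hN hg), fun γ => tendsto_nhds_unique (hl _) ?_⟩, hl⟩
  refine tendsto_const_nhds.congr fun n => ?_
  have := hN.normal n
  have := hN.finiteIndex n
  rw [CZeroInt.permLogDet_ofGroup, toAdd_one, mul_zero]

/-- `logDetKOne` is an arbitrary choice; uniqueness identifies it with the limit homomorphism of the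
given sequence. -/
theorem tendsto_logDet (hWh : IsMulTorsion (WhiteheadGroup p Γ)) {N : ℕ → Subgroup Γ}
    (hN : TendsToIdentity N) [∀ n, Fintype (Γ ⧸ N n)] [∀ n, DecidableEq (Γ ⧸ N n)] {r : ℕ}
    (F : GL (Fin r) (CZeroInt p Γ)) : Tendsto (fun n => ((N n).index : ℚ_[p])⁻¹ *
      (unitLog p (CZeroInt.permDet p Γ (Γ ⧸ N n) r F)).toAdd) atTop (𝓝 (logDet p F)) := by
  obtain ⟨L, hL, hlim⟩ := exists_isLogDet_tendsto hWh hN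
  have h : ∃ L, IsLogDet p Γ L := ⟨L, hL⟩
  have h' : logDetKOne p Γ = L := by
    rw [logDetKOne, dif_pos h]
    exact IsLogDet.unique hWh h.choose_spec hL
  rw [logDet, h']
  exact hlim (KOne.mk F)

variable (Γ) in
theorem exists_tendsToIdentity [Countable Γ] [Group.ResiduallyFinite Γ] :
    ∃ N : ℕ → Subgroup Γ, TendsToIdentity N := by
  have h : ∀ γ : Γ, ∃ H : Subgroup Γ, H.Normal ∧ H.FiniteIndex ∧ (γ ≠ 1 → γ ∉ H) := fun γ => by
    by_cases hγ : γ = 1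
    · exact ⟨⊤, inferInstance, inferInstance, fun h => absurd hγ h⟩
    · obtain ⟨H, hH⟩ := Group.exists_finiteIndexNormalSubgroup_notMem γ hγ
      exact ⟨H.toSubgroup, H.isNormal', H.isFiniteIndex', fun _ => hH⟩
  choose H hn hf hmem using h
  obtain ⟨e, he⟩ := exists_surjective_nat Γ
  -- Once `n > k`, the intersection is contained in `H (e k)` and so omits `e k` unless `e k = 1`.
  refine ⟨fun n => ⨅ i : Fin n, H (e i), fun n => Subgroup.normal_iInf_normal fun i => hn _,
    fun n => Subgroup.finiteIndex_iInf fun i => hf _, fun γ hγ => ?_⟩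
  by_contra hne
  obtain ⟨k, rfl⟩ := he γ
  obtain ⟨n, hn, hkn⟩ := hγ.exists_gt k
  exact hmem _ hne ((Subgroup.mem_iInf.1 hn) ⟨k, hkn⟩)

end LogDetExistence

/-! ### Zeros of an integral matrix on a torus -/

noncomputable section TorusKernel

variable {m : Type*} [Fintype m] [DecidableEq m]

theorem Matrix.card_quotient_range_toLin' {M : Matrix m m ℤ} (hM : M.det ≠ 0) :
    Nat.card ((m → ℤ) ⧸ LinearMap.range (Matrix.toLin' M)) = M.det.natAbs := by
  have hinj : Function.Injective (Matrix.toLin' M) := by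
    rw [Matrix.toLin'_apply']
    exact Matrix.mulVec_injective_of_det_ne_zero hM
  rw [← Submodule.natAbs_det_equiv _ (LinearEquiv.ofInjective (Matrix.toLin' M) hinj),
    ← LinearMap.det_toLin']
  rfl

/-- The lattice point `v` is sent to the class of `M⁻¹ v` in the torus. -/
def torusSolution (M : Matrix m m ℤ) : (m → ℤ) →ₗ[ℤ] (m → UnitAddCircle) :=
  AddMonoidHom.toIntLinearMap
    { toFun := fun v i => (((M.map (Int.cast : ℤ → ℝ))⁻¹.mulVec (fun j => (v j : ℝ)) i : ℝ) :
        UnitAddCircle)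
      map_zero' := by
        ext i
        simp [Matrix.mulVec, dotProduct]
      map_add' := fun v w => by
        ext i
        simp [Matrix.mulVec, dotProduct, mul_add, Finset.sum_add_distrib] }

theorem torusSolution_apply (M : Matrix m m ℤ) (v : m → ℤ) (i : m) : torusSolution M v i =
    (((M.map (Int.cast : ℤ → ℝ))⁻¹.mulVec (fun j => (v j : ℝ)) i : ℝ) : UnitAddCircle) := rfl

omit [DecidableEq m] in
theorem UnitAddCircle.coe_sum_zsmul (M : Matrix m m ℤ) (w : m → ℝ) (i : m) :
    ∑ j, M i j • (w j : UnitAddCircle) =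
      (((M.map (Int.cast : ℤ → ℝ)).mulVec w i : ℝ) : UnitAddCircle) := by
  rw [Matrix.mulVec, dotProduct]
  refine Eq.trans ?_ (map_sum (QuotientAddGroup.mk' (AddSubgroup.zmultiples (1 : ℝ))) _ _).symm
  refine Finset.sum_congr rfl fun j _ => ?_
  rw [Matrix.map_apply, ← zsmul_eq_mul, map_zsmul]
  rfl

theorem UnitAddCircle.coe_eq_zero_iff_int {x : ℝ} : (x : UnitAddCircle) = 0 ↔ ∃ n : ℤ, (n : ℝ) = x := by
  rw [AddCircle.coe_eq_zero_iff]
  simp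

/-- An integral matrix `M` with `det M ≠ 0` has `|det M|` zeros in the torus `(ℝ/ℤ)^m`. -/
theorem card_torus_kernel {M : Matrix m m ℤ} (hM : M.det ≠ 0) :
    Nat.card {z : m → UnitAddCircle // ∀ i, ∑ j, M i j • z j = 0} = M.det.natAbs := by
  have hdet : IsUnit (M.map (Int.cast : ℤ → ℝ)).det := by
    have : (M.map (Int.cast : ℤ → ℝ)).det = (M.det : ℝ) :=
      (RingHom.map_det (Int.castRingHom ℝ) M).symm
    rw [this, isUnit_iff_ne_zero]
    exact_mod_cast hM
  have hcast : ∀ u : m → ℤ, (M.map (Int.cast : ℤ → ℝ)).mulVec (fun j => (u j : ℝ)) =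
      fun i => ((M.mulVec u i : ℤ) : ℝ) := fun u => by
    ext i
    simp [Matrix.mulVec, dotProduct]
  -- `M⁻¹ v` is integral exactly when `v ∈ M ℤᵐ`. With `hrange` this identifies the zeros with `ℤᵐ /
  -- M ℤᵐ`, a group of order `|det M|`.
  have hker : LinearMap.ker (torusSolution M) = LinearMap.range (Matrix.toLin' M) := by
    ext v
    rw [LinearMap.mem_ker, LinearMap.mem_range]
    constructor
    · intro h
      choose u hu using fun i => UnitAddCircle.coe_eq_zero_iff_int.1 (congrFun h i)
      refine ⟨u, ?_⟩
      have h1 := hcast u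
      rw [funext hu, Matrix.mulVec_mulVec, Matrix.mul_nonsing_inv _ hdet, Matrix.one_mulVec] at h1
      ext i
      rw [Matrix.toLin'_apply]
      exact_mod_cast (congrFun h1 i).symm
    · rintro ⟨u, rfl⟩
      ext i
      rw [torusSolution_apply, Matrix.toLin'_apply, ← hcast, Matrix.mulVec_mulVec,
        Matrix.nonsing_inv_mul _ hdet, Matrix.one_mulVec]
      exact UnitAddCircle.coe_eq_zero_iff_int.2 ⟨u i, rfl⟩
  have hrange : {z : m → UnitAddCircle | ∀ i, ∑ j, M i j • z j = 0} =
      (LinearMap.range (torusSolution M) : Set (m → UnitAddCircle)) := by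
    ext z
    rw [Set.mem_ofPred_eq, SetLike.mem_coe, LinearMap.mem_range]
    constructor
    · intro h
      -- Lift `z` to a real vector `w`; the equations say that `v = M w` is integral, so `z` is the
      -- class of `M⁻¹ v`.
      choose w hw using fun j => QuotientAddGroup.mk_surjective (z j)
      obtain rfl : (fun j => (w j : UnitAddCircle)) = z := funext hw
      simp only [UnitAddCircle.coe_sum_zsmul, UnitAddCircle.coe_eq_zero_iff_int] at h
      choose v hv using h
      refine ⟨v, ?_⟩
      ext i
      rw [torusSolution_apply, funext hv, Matrix.mulVec_mulVec, Matrix.nonsing_inv_mul _ hdet,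
        Matrix.one_mulVec]
    · rintro ⟨v, rfl⟩ i
      simp only [torusSolution_apply]
      rw [UnitAddCircle.coe_sum_zsmul, Matrix.mulVec_mulVec, Matrix.mul_nonsing_inv _ hdet,
        Matrix.one_mulVec]
      exact UnitAddCircle.coe_eq_zero_iff_int.2 ⟨v i, rfl⟩
  rw [← Matrix.card_quotient_range_toLin' hM, ← hker,
    Nat.card_congr (torusSolution M).quotKerEquivRange.toEquiv]
  exact Nat.card_congr (Equiv.setCongr hrange)

end TorusKernel

/-! ### Periodic points of `X_f` -/

noncomputable section PeriodicPoints

variable {Γ : Type*} [Group Γ] {Q : Type*} [Fintype Q] [DecidableEq Q] [MulAction Γ Q] {r : ℕ}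

/-- The matrix of `f ∈ M_r(ℤΓ)` in the permutation representation on `Q`. -/
def intPermMatrix (Q : Type*) [DecidableEq Q] [MulAction Γ Q]
    (f : Matrix (Fin r) (Fin r) (MonoidAlgebra ℤ Γ)) : Matrix (Fin r × Q) (Fin r × Q) ℤ :=
  Matrix.of fun x y => (f x.1 y.1).coeff.sum fun δ c => if δ • y.2 = x.2 then c else 0

theorem CZeroInt.permRepMatrix_ofGroupRing (p : ℕ) [Fact p.Prime]
    (f : Matrix (Fin r) (Fin r) (MonoidAlgebra ℤ Γ)) :
    CZeroInt.permRepMatrix p Γ Q r (f.map (CZeroInt.ofGroupRing p)) =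
      (intPermMatrix Q f).map (Int.cast : ℤ → ℤ_[p]) := by
  apply Matrix.coePadic_injective
  ext x y
  change CZero.permRep p Γ Q (CZeroInt.ofGroupRing p (f x.1 y.1) : CZero p Γ) x.2 y.2 =
    (((intPermMatrix Q f x y : ℤ) : ℤ_[p]) : ℚ_[p])
  rw [CZero.permRep_apply, PadicInt.coe_intCast, intPermMatrix, Matrix.of_apply, Finsupp.sum,
    tsum_eq_sum (s := (f x.1 y.1).coeff.support)]
  · push_cast
    rfl
  · intro δ hδ
    have : (f x.1 y.1).coeff δ = 0 := Finsupp.notMem_support_iff.1 hδ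
    split_ifs
    · change (((f x.1 y.1).coeff δ : ℤ) : ℚ_[p]) = 0
      rw [this, Int.cast_zero]
    · rfl

/-- Collects the `δ` according to the point `b = δ⁻¹ • a`; the coefficients with `δ • b = a` add up
to the matrix entry. -/
theorem finsum_eq_sum_intPermMatrix (f : Matrix (Fin r) (Fin r) (MonoidAlgebra ℤ Γ))
    (z : Fin r × Q → UnitAddCircle) (a : Q) (i : Fin r) :
    (∑ᶠ δ : Γ, (fun i => ∑ j, (f i j).coeff δ • z (j, δ⁻¹ • a))) i =
      ∑ y, intPermMatrix Q f (i, a) y • z y := by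
  classical
  let s : Finset Γ := Finset.univ.biUnion fun i => Finset.univ.biUnion fun j => (f i j).coeff.support
  have hs : ∀ δ ∉ s, ∀ i j, (f i j).coeff δ = 0 := fun δ hδ i j => by
    by_contra h
    exact hδ (Finset.mem_biUnion.2 ⟨i, Finset.mem_univ _, Finset.mem_biUnion.2
      ⟨j, Finset.mem_univ _, Finsupp.mem_support_iff.2 h⟩⟩)
  rw [finsum_eq_sum_of_support_subset (s := s)]
  · rw [Finset.sum_apply, Finset.sum_comm, Fintype.sum_prod_type]
    refine Finset.sum_congr rfl fun j _ => ?_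
    have h1 : ∀ b : Q, intPermMatrix Q f (i, a) (j, b) • z (j, b) =
        ∑ δ ∈ s, (if δ • b = a then (f i j).coeff δ else 0) • z (j, b) := fun b => by
      rw [intPermMatrix, Matrix.of_apply, Finsupp.sum_of_support_subset (s := s), Finset.sum_smul]
      · intro δ hδ
        exact Finset.mem_biUnion.2 ⟨i, Finset.mem_univ _, Finset.mem_biUnion.2
          ⟨j, Finset.mem_univ _, hδ⟩⟩
      · intros
        split_ifs <;> rfl
    simp_rw [h1]
    rw [Finset.sum_comm]
    refine Finset.sum_congr rfl fun δ _ => ?_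
    rw [Finset.sum_eq_single (δ⁻¹ • a)]
    · rw [smul_inv_smul, if_pos rfl]
    · intro b _ hb
      rw [if_neg, zero_smul]
      rintro rfl
      exact hb (inv_smul_smul _ _).symm
    · simp
  · intro δ hδ
    by_contra h
    refine hδ ?_
    ext i
    simp [hs δ h]

variable {N : Subgroup Γ}

/-- The function on `Γ` defined by a function on `Γ ⧸ N`. -/
def inflate (z : Fin r × (Γ ⧸ N) → UnitAddCircle) : Γ → Fin r → UnitAddCircle :=
  fun γ j => z (j, ((γ⁻¹ : Γ) : Γ ⧸ N))

/-- After `γ' = γ δ` the coset of `γ'⁻¹` is `δ⁻¹` applied to that of `γ⁻¹`, so the equation of `X_f`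
at `γ` is the block of rows indexed by the coset of `γ⁻¹`. -/
theorem inflate_mem_XSet [Fintype (Γ ⧸ N)] [DecidableEq (Γ ⧸ N)]
    {f : Matrix (Fin r) (Fin r) (MonoidAlgebra ℤ Γ)} {z : Fin r × (Γ ⧸ N) → UnitAddCircle} :
    inflate z ∈ XSet f ↔ ∀ x, ∑ y, intPermMatrix (Γ ⧸ N) f x y • z y = 0 := by
  have key : ∀ γ : Γ, (∑ᶠ γ' : Γ, (fun i => ∑ j, (f i j).coeff (γ⁻¹ * γ') • inflate z γ' j)) =
      fun i => ∑ y, intPermMatrix (Γ ⧸ N) f (i, ((γ⁻¹ : Γ) : Γ ⧸ N)) y • z y := fun γ => by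
    ext i
    rw [← finsum_eq_sum_intPermMatrix, ← finsum_comp_equiv (Equiv.mulLeft γ)]
    refine congrFun (finsum_congr fun δ => ?_) i
    ext k
    refine Finset.sum_congr rfl fun j _ => ?_
    rw [Equiv.coe_mulLeft, inv_mul_cancel_left, inflate, mul_inv_rev, MulAction.Quotient.smul_mk,
      smul_eq_mul]
  rw [XSet, Set.mem_ofPred_eq]
  simp only [key]
  constructor
  · rintro h ⟨i, a⟩
    obtain ⟨γ, rfl⟩ := QuotientGroup.mk_surjective a
    simpa using congrFun (h γ⁻¹) i
  · intro h γ
    exact funext fun i => h _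

theorem inflate_injective : Function.Injective (inflate : (Fin r × (Γ ⧸ N) → UnitAddCircle) → _) := by
  intro z w h
  ext ⟨j, a⟩
  obtain ⟨γ, rfl⟩ := QuotientGroup.mk_surjective a
  simpa [inflate] using congrFun (congrFun h γ⁻¹) j

/-- Invariance says `x (n⁻¹ γ) = x γ` for `n ∈ N`, so `x γ` depends only on the left coset of `γ⁻¹`;
hence the inverse in `inflate`. -/
theorem mem_fixedPoints_iff_exists_inflate {f : Matrix (Fin r) (Fin r) (MonoidAlgebra ℤ Γ)}
    {x : XSpace f} : x ∈ MulAction.fixedPoints N (XSpace f) ↔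
      ∃ z : Fin r × (Γ ⧸ N) → UnitAddCircle, inflate z = x.1 := by
  rw [MulAction.mem_fixedPoints]
  constructor
  · intro h
    refine ⟨fun y => x.1 (y.2.out⁻¹) y.1, ?_⟩
    ext γ j
    obtain ⟨n, hn⟩ := QuotientGroup.mk_out_eq_mul N γ⁻¹
    rw [inflate, hn, mul_inv_rev, inv_inv]
    have := congrArg (fun y : XSpace f => y.1 γ j) (h n)
    exact this
  · rintro ⟨z, hz⟩ n
    apply Subtype.ext
    ext γ j
    change x.1 ((n : Γ)⁻¹ * γ) j = _
    rw [← hz, inflate, inflate, mul_inv_rev, inv_inv, QuotientGroup.mk_mul_of_mem _ n.2]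

theorem ncard_fixedPoints [Fintype (Γ ⧸ N)] [DecidableEq (Γ ⧸ N)]
    {f : Matrix (Fin r) (Fin r) (MonoidAlgebra ℤ Γ)} (hf : (intPermMatrix (Γ ⧸ N) f).det ≠ 0) :
    (MulAction.fixedPoints N (XSpace f)).ncard = (intPermMatrix (Γ ⧸ N) f).det.natAbs := by
  rw [← card_torus_kernel hf]
  let Φ : {z : Fin r × (Γ ⧸ N) → UnitAddCircle //
      ∀ x, ∑ y, intPermMatrix (Γ ⧸ N) f x y • z y = 0} → XSpace f :=
    fun z => ⟨inflate z.1, inflate_mem_XSet.2 z.2⟩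
  have hΦ : Function.Injective Φ := fun z w h =>
    Subtype.ext (inflate_injective (congrArg Subtype.val h))
  have hrange : MulAction.fixedPoints N (XSpace f) = Set.range Φ := by
    ext x
    rw [mem_fixedPoints_iff_exists_inflate]
    constructor
    · rintro ⟨z, hz⟩
      exact ⟨⟨z, inflate_mem_XSet.1 (hz ▸ x.2)⟩, Subtype.ext hz⟩
    · rintro ⟨z, rfl⟩
      exact ⟨z.1, rfl⟩
  rw [hrange, ← Nat.card_coe_set_eq, Nat.card_range_of_injective hΦ]

end PeriodicPoints

open Filter Topology in
theorem theorem5p6 (p : ℕ) [Fact p.Prime] (Γ : Type*) [Group Γ] [Countable Γ]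
    [Group.ResiduallyFinite Γ] (hWh : IsMulTorsion (WhiteheadGroup p Γ)) :
    (∃! L : KOne (CZeroInt p Γ) →* Multiplicative ℚ_[p], IsLogDet p Γ L) ∧
    ∀ (r : ℕ) (f : Matrix (Fin r) (Fin r) (MonoidAlgebra ℤ Γ)) (F : GL (Fin r) (CZeroInt p Γ)),
      (F : Matrix (Fin r) (Fin r) (CZeroInt p Γ)) = f.map (CZeroInt.ofGroupRing p) →
      ∀ N : ℕ → Subgroup Γ, TendsToIdentity N → HasPadicEntropy p (XSpace f) N (logDet p F) := by
  classical
  refine ⟨?_, fun r f F hF N hN => ?_⟩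
  -- For existence any one sequence suffices; countability and residual finiteness provide it.
  · obtain ⟨N, hN⟩ := exists_tendsToIdentity Γ
    have := hN.finiteIndex
    have : ∀ n, Fintype (Γ ⧸ N n) := fun n => Fintype.ofFinite _
    obtain ⟨L, hL, -⟩ := exists_isLogDet_tendsto hWh hN
    exact ⟨L, hL, fun L' hL' => IsLogDet.unique hWh hL' hL⟩
  · have := hN.finiteIndex
    have : ∀ n, Fintype (Γ ⧸ N n) := fun n => Fintype.ofFinite _
    have hcoe : ∀ n, (CZeroInt.permDet p Γ (Γ ⧸ N n) r F : ℤ_[p]) =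
        ((intPermMatrix (Γ ⧸ N n) f).det : ℤ_[p]) := fun n => by
      rw [CZeroInt.coe_permDet, hF, CZeroInt.permRepMatrix_ofGroupRing]
      exact (RingHom.map_det (Int.castRingHom ℤ_[p]) _).symm
    -- Invertibility of `F` over `c₀(Γ, ℤ_p)` makes the image of this integer in `ℤ_p` a unit.
    have hdet : ∀ n, (intPermMatrix (Γ ⧸ N n) f).det ≠ 0 := fun n h => by
      have := hcoe n
      rw [h, Int.cast_zero] at this
      exact (CZeroInt.permDet p Γ (Γ ⧸ N n) r F).ne_zero this
    have hcard := fun n => ncard_fixedPoints (hdet n)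
    have hpos : ∀ n, (MulAction.fixedPoints (N n) (XSpace f)).ncard ≠ 0 := fun n => by
      rw [hcard, Int.natAbs_ne_zero]
      exact hdet n
    refine ⟨fun n => ⟨Set.finite_of_ncard_ne_zero (hpos n), Set.nonempty_of_ncard_ne_zero (hpos n)⟩,
      (tendsto_logDet hWh hN F).congr fun n => ?_⟩
    have hneg := padicLog_neg_units (CZeroInt.permDet p Γ (Γ ⧸ N n) r F)
    rw [hcoe, PadicInt.coe_intCast] at hneg
    rw [hcard, unitLog_apply, hcoe, PadicInt.coe_intCast, Nat.cast_natAbs]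
    rcases abs_choice (intPermMatrix (Γ ⧸ N n) f).det with h | h
    · rw [h]
    · rw [h, Int.cast_neg, hneg]
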